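/- Let $a_0,a_+,a_-\in\mathbb{R}$ and let $\phi:\mathbb{Z}\to\mathbb{C}$ be given by $\phi(0)=a_0$, $\phi(\pm1)=a_\pm$ and $\phi(x)=0$ otherwise. Assume that $a_+a_-<0$ and $4|a_+a_-|=a_0|a_++a_-|$ (these force $a_0>0$ and $a_++a_-\neq0$). Let $\phi^{(1)}=\phi$, $\phi^{(n)}(x)=\sum_{y\in\mathbb{Z}}\phi^{(n-1)}(x-y)\phi(y)$ be the convolution powers of $\phi$, let $\|\phi^{(n)}\|_\infty=\sup_{x\in\mathbb{Z}}|\phi^{(n)}(x)|$, and let $$H_3^\beta(y)=\frac1{2\pi}\int_{\mathbb{R}}e^{-iyu}e^{-\beta u^3}\,du\qquad(y\in\mathbb{R})$$ be understood as an improper Riemann integral. Set $$A=a_0+a_++a_-,\quad \alpha=\frac{a_+-a_-}{A}\quad\text{if }a_++a_->0,\qquad A=a_0-a_+-a_-,\quad \alpha=\frac{a_--a_+}{A}\quad\text{if }a_++a_-<0,$$ and $\beta=i(\alpha-\alpha^3)/6$. Then the integral defining $H_3^\beta(y)$ converges for every $y\in\mathbb{R}$, and the following hold. 1. If $a_++a_->0$,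 then, as $n\to\infty$, uniformly for $x\in\mathbb{Z}$, $$\phi^{(n)}(x)=n^{-1/3}A^nH_3^\beta\left(\frac{x-\alpha n}{n^{1/3}}\right)+o(A^nn^{-1/3}).$$ 2. If $a_++a_-<0$, then, as $n\to\infty$, uniformly for $x\in\mathbb{Z}$, $$\phi^{(n)}(x)=n^{-1/3}A^ne^{-ix\pi}H_3^\beta\left(\frac{x-\alpha n}{n^{1/3}}\right)+o(A^nn^{-1/3}).$$ 3. In either case there is a compact set $K\subseteq\mathbb{R}$ such that, for every integer $n\ge1$, the supremum $\|\phi^{(n)}\|_\infty$ is attained at some integer point of the set $\alpha n+Kn^{1/3}$. -/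

import Mathlib

open Filter Topology

noncomputable section

/-- Convolution powers of `φ : ℤ → ℂ`: `φ⁽ⁿ⁺¹⁾(x) = ∑_y φ⁽ⁿ⁾(x - y) φ(y)`. The recursion starts from
the unit mass at `0`, so that `φ⁽¹⁾ = φ` (see `convPow_one`). -/
def convPow (φ : ℤ → ℂ) : ℕ → ℤ → ℂ
  | 0 => Pi.single 0 1
  | n + 1 => fun x => ∑' y : ℤ, convPow φ n (x - y) * φ y

theorem convPow_one (φ : ℤ → ℂ) : convPow φ 1 = φ := by
  funext x
  simp only [convPow]
  rw [tsum_eq_single x]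
  · simp
  · intro y hy
    have h : x - y ≠ 0 := sub_ne_zero.mpr (Ne.symm hy)
    simp [h]

/-- `f` has the improper Riemann integral `l` over the whole line: `∫_a^b f → l` as `a → -∞` and
`b → +∞` independently. -/
def HasImproperIntegral (f : ℝ → ℂ) (l : ℂ) : Prop :=
  Tendsto (fun p : ℝ × ℝ => ∫ u in p.1..p.2, f u) (atBot ×ˢ atTop) (𝓝 l)

/-- The value of the improper Riemann integral of `f` over the line (meaningful when it converges). -/
def improperIntegral (f : ℝ → ℂ) : ℂ :=
  limUnder (atBot ×ˢ atTop) (fun p : ℝ × ℝ => ∫ u in p.1..p.2, f u)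

theorem HasImproperIntegral.eq {f : ℝ → ℂ} {l : ℂ} (h : HasImproperIntegral f l) :
    improperIntegral f = l :=
  Tendsto.limUnder_eq h

/-- The integrand `u ↦ e^{-ixu} e^{-β u^m}`. -/
def attractorIntegrand (m : ℕ) (β : ℂ) (x u : ℝ) : ℂ :=
  Complex.exp (-(Complex.I * (x : ℂ) * (u : ℂ))) * Complex.exp (-(β * (u : ℂ) ^ m))

/-- The attractor `H_m^β(x) = (1/2π) ∫_ℝ e^{-ixu} e^{-β u^m} du` (improper Riemann integral). -/
def attractor (m : ℕ) (β : ℂ) (x : ℝ) : ℂ :=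
  1 / (2 * (Real.pi : ℂ)) * improperIntegral (attractorIntegrand m β x)

end

/-! The proof is Fourier analysis of the symbol `a₀ + ap e^{iξ} + am e^{-iξ}`. When `ap + am > 0`,
the hypothesis `4|ap am| = a₀(ap + am)` gives `(ap - am)² = A(ap + am)`, that is `ap + am = Aα²`.
Hence the symbol is `A p(ξ)` with `p(ξ) = 1 - α²(1 - cos ξ) + iα sin ξ`, the Lax-Wendroff symbol,
where `0 < α² < 1`. Since `|p|² = 1 - α²(1 - α²)(1 - cos ξ)²`, the modulus on `[-π, π]` reaches its
maximum `1` only at `ξ = 0`, and there `p(ξ) = exp(i(αξ - bξ³)) + O(ξ⁴)` with `b = (α - α³)/6`.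
Inserting `ξ = u n^{-1/3}` in Fourier inversion produces the integral of `e^{-iyu} e^{-ibu³}`.

The difficulty is that `|p|^n` is still of order one when `|ξ|` is about `n^{-1/4}`, far outside the
scale `n^{-1/3}`, so the tails cannot be bounded by absolute values. Van der Corput's
second-derivative estimate bounds them instead: the phase `n arg p(ξ) - xξ` has second derivative of
size at least a constant times `nξ`, whatever `x` is. This makes the limit uniform in `x`
(`norm_integral_laxSymbol_near_le`, `norm_center_sub_truncIntegral_le`,
`exists_norm_laxIntegral_sub_le`). The same estimate gives convergence and continuity of the limit
profile and, with Riemann-Lebesgue, its decay at infinity.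

The statement on maxima follows because the profile is nonzero at `0`
(`attractor_three_zero_ne_zero`) and vanishes at infinity, so for large `n` no maximiser lies
outside a fixed rescaled window (`exists_isCompact_max_of_local_limit`). The case `ap + am < 0`
reduces to the first by multiplying `φ` by `(-1)^x`. -/

/-! ### Van der Corput estimates for oscillatory integrals -/

/-- First-derivative van der Corput estimate. -/
theorem norm_integral_cexp_le_of_le_deriv {f f' f'' : ℝ → ℝ} {a b μ : ℝ} (hab : a ≤ b)
    (hf : ∀ t ∈ Set.Icc a b, HasDerivAt f (f' t) t)
    (hf' : ∀ t ∈ Set.Icc a b, HasDerivAt f' (f'' t) t)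
    (hc : ContinuousOn f'' (Set.Icc a b)) (hpos : ∀ t ∈ Set.Icc a b, 0 ≤ f'' t)
    (hμ : 0 < μ) (h : ∀ t ∈ Set.Icc a b, μ ≤ f' t) :
    ‖∫ t in a..b, Complex.exp (Complex.I * f t)‖ ≤ 2 / μ := by
  have hne : ∀ t ∈ Set.Icc a b, 0 < f' t := fun t ht => hμ.trans_le (h t ht)
  have hcf : ContinuousOn f (Set.Icc a b) := fun t ht => (hf t ht).continuousAt.continuousWithinAt
  have hcf' : ContinuousOn f' (Set.Icc a b) :=
    fun t ht => (hf' t ht).continuousAt.continuousWithinAt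
  have hce : ContinuousOn (fun t => Complex.exp (Complex.I * f t)) (Set.Icc a b) := by fun_prop
  have hq : ContinuousOn (fun t => f'' t / f' t ^ 2) (Set.Icc a b) :=
    hc.div (hcf'.pow 2) fun t ht => (pow_pos (hne t ht) 2).ne'
  have hr : ContinuousOn (fun t => Complex.exp (Complex.I * f t) * (f'' t / f' t ^ 2 : ℝ))
      (Set.Icc a b) := hce.mul (Complex.continuous_ofReal.comp_continuousOn hq)
  have hii : IntervalIntegrable (fun t => Complex.exp (Complex.I * f t)) MeasureTheory.volume a b :=
    hce.intervalIntegrable_of_Icc hab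
  have hri := hr.intervalIntegrable_of_Icc (μ := MeasureTheory.volume) hab
  have hqi := hq.intervalIntegrable_of_Icc (μ := MeasureTheory.volume) hab
  have hG : ∀ t ∈ Set.uIcc a b, HasDerivAt
      (fun t => Complex.exp (Complex.I * f t) * ((f' t : ℂ))⁻¹)
      (Complex.I * Complex.exp (Complex.I * f t)
        - Complex.exp (Complex.I * f t) * (f'' t / f' t ^ 2 : ℝ)) t := by
    intro t ht
    rw [Set.uIcc_of_le hab] at ht
    have h0 : (f' t : ℂ) ≠ 0 := by exact_mod_cast (hne t ht).ne'
    have h1 := (((hf t ht).ofReal_comp).const_mul Complex.I).cexp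
    have h2 := ((hf' t ht).ofReal_comp).fun_inv h0
    refine (h1.fun_mul h2).congr_deriv ?_
    push_cast
    field_simp
    ring
  have hint := intervalIntegral.integral_eq_sub_of_hasDerivAt hG ((hii.const_mul _).sub hri)
  rw [intervalIntegral.integral_sub (hii.const_mul _) hri,
    intervalIntegral.integral_const_mul] at hint
  have hH : ∀ t ∈ Set.uIcc a b, HasDerivAt (fun t => -(f' t)⁻¹) (f'' t / f' t ^ 2) t := by
    intro t ht
    rw [Set.uIcc_of_le hab] at ht
    refine ((hf' t ht).fun_inv (hne t ht).ne').fun_neg.congr_deriv ?_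
    ring
  have hint2 := intervalIntegral.integral_eq_sub_of_hasDerivAt hH hqi
  -- Since `f'` is monotone, the total variation of `1/f'` telescopes to its endpoint values.
  have hbound : ‖∫ t in a..b, Complex.exp (Complex.I * f t) * (f'' t / f' t ^ 2 : ℝ)‖
      ≤ (f' a)⁻¹ - (f' b)⁻¹ := by
    calc _ ≤ ∫ t in a..b, f'' t / f' t ^ 2 := by
          refine intervalIntegral.norm_integral_le_of_norm_le hab ?_ hqi
          refine Filter.Eventually.of_forall fun t ht => ?_
          have ht' : t ∈ Set.Icc a b := ⟨ht.1.le, ht.2⟩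
          rw [norm_mul, mul_comm Complex.I, Complex.norm_exp_ofReal_mul_I, one_mul,
            Complex.norm_real, Real.norm_of_nonneg]
          exact div_nonneg (hpos t ht') (by positivity)
      _ = _ := by rw [hint2]; ring
  have hea : ∀ t ∈ Set.Icc a b, ‖Complex.exp (Complex.I * f t) * ((f' t : ℂ))⁻¹‖ = (f' t)⁻¹ := by
    intro t ht
    rw [norm_mul, mul_comm Complex.I, Complex.norm_exp_ofReal_mul_I, one_mul, norm_inv,
      Complex.norm_real, Real.norm_of_nonneg (hne t ht).le]
  have ha : a ∈ Set.Icc a b := ⟨le_rfl, hab⟩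
  have hb : b ∈ Set.Icc a b := ⟨hab, le_rfl⟩
  have key : Complex.I * ∫ t in a..b, Complex.exp (Complex.I * f t)
      = Complex.exp (Complex.I * f b) * ((f' b : ℂ))⁻¹
        - Complex.exp (Complex.I * f a) * ((f' a : ℂ))⁻¹
        + ∫ t in a..b, Complex.exp (Complex.I * f t) * (f'' t / f' t ^ 2 : ℝ) := by
    rw [← hint]; ring
  have hnorm : ‖∫ t in a..b, Complex.exp (Complex.I * f t)‖
      = ‖Complex.I * ∫ t in a..b, Complex.exp (Complex.I * f t)‖ := by simp
  rw [hnorm, key]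
  have hinv : (f' a)⁻¹ ≤ μ⁻¹ := inv_anti₀ hμ (h a ha)
  calc _ ≤ (f' b)⁻¹ + (f' a)⁻¹ + ((f' a)⁻¹ - (f' b)⁻¹) := by
        refine (norm_add_le _ _).trans (add_le_add ((norm_sub_le _ _).trans ?_) hbound)
        rw [hea a ha, hea b hb]
    _ = 2 * (f' a)⁻¹ := by ring
    _ ≤ 2 * μ⁻¹ := by linarith
    _ = 2 / μ := by ring

/-- The interval is cut at distance `1/√lam` from `c`: the near piece is bounded by its length, and
on the far piece `f' ≥ √lam`, so the first-derivative estimate gives `2/√lam`. -/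
theorem norm_integral_cexp_le_of_linear_le_deriv {f f' f'' : ℝ → ℝ} {c b lam : ℝ} (hcb : c ≤ b)
    (hf : ∀ t ∈ Set.Icc c b, HasDerivAt f (f' t) t)
    (hf' : ∀ t ∈ Set.Icc c b, HasDerivAt f' (f'' t) t)
    (hc : ContinuousOn f'' (Set.Icc c b)) (hpos : ∀ t ∈ Set.Icc c b, 0 ≤ f'' t)
    (hlam : 0 < lam) (h : ∀ t ∈ Set.Icc c b, lam * (t - c) ≤ f' t) :
    ‖∫ t in c..b, Complex.exp (Complex.I * f t)‖ ≤ 3 / √lam := by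
  have hs : 0 < √lam := Real.sqrt_pos.2 hlam
  have hss : √lam * √lam = lam := Real.mul_self_sqrt hlam.le
  have htriv : ∀ d, c ≤ d → ‖∫ t in c..d, Complex.exp (Complex.I * f t)‖ ≤ d - c := by
    intro d hd
    have := intervalIntegral.norm_integral_le_of_norm_le_const (a := c) (b := d) (C := 1)
      (f := fun t => Complex.exp (Complex.I * f t))
      (fun t _ => by rw [mul_comm, Complex.norm_exp_ofReal_mul_I])
    rwa [one_mul, abs_of_nonneg (by linarith)] at this
  rcases le_total b (c + 1 / √lam) with hb | hb
  · refine (htriv b hcb).trans ?_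
    calc b - c ≤ 1 / √lam := by linarith
      _ ≤ 3 / √lam := by gcongr; norm_num
  · set d := c + 1 / √lam with hd
    have hcd : c ≤ d := by rw [hd]; have : 0 < 1 / √lam := by positivity
                           linarith
    have hsub : Set.Icc d b ⊆ Set.Icc c b := Set.Icc_subset_Icc_left hcd
    have hce : ContinuousOn (fun t => Complex.exp (Complex.I * f t)) (Set.Icc c b) := by
      have : ContinuousOn f (Set.Icc c b) :=
        fun t ht => (hf t ht).continuousAt.continuousWithinAt
      fun_prop
    have h2 := norm_integral_cexp_le_of_le_deriv hb (fun t ht => hf t (hsub ht))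
      (fun t ht => hf' t (hsub ht)) (hc.mono hsub) (fun t ht => hpos t (hsub ht)) hs
      (fun t ht => by
        refine le_trans ?_ (h t (hsub ht))
        have : 1 / √lam ≤ t - c := by have := ht.1; linarith
        calc √lam = lam * (1 / √lam) := by rw [← hss]; field_simp; simp
          _ ≤ _ := by gcongr)
    have hadd := intervalIntegral.integral_add_adjacent_intervals
      (ContinuousOn.intervalIntegrable_of_Icc (μ := MeasureTheory.volume) hcd
        (hce.mono (Set.Icc_subset_Icc_right hb)))
      (ContinuousOn.intervalIntegrable_of_Icc (μ := MeasureTheory.volume) hb (hce.mono hsub))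
    rw [← hadd]
    calc _ ≤ (d - c) + 2 / √lam := (norm_add_le _ _).trans (add_le_add (htriv d hcd) h2)
      _ = 3 / √lam := by rw [hd]; ring

/-- Second-derivative van der Corput estimate. -/
theorem norm_integral_cexp_le_of_le_deriv2 {f f' f'' : ℝ → ℝ} {a b lam : ℝ} (hab : a ≤ b)
    (hf : ∀ t ∈ Set.Icc a b, HasDerivAt f (f' t) t)
    (hf' : ∀ t ∈ Set.Icc a b, HasDerivAt f' (f'' t) t)
    (hc : ContinuousOn f'' (Set.Icc a b)) (hlam : 0 < lam) (h : ∀ t ∈ Set.Icc a b, lam ≤ f'' t) :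
    ‖∫ t in a..b, Complex.exp (Complex.I * f t)‖ ≤ 6 / √lam := by
  have hcf' : ContinuousOn f' (Set.Icc a b) :=
    fun t ht => (hf' t ht).continuousAt.continuousWithinAt
  have hgrow : ∀ s ∈ Set.Icc a b, ∀ t ∈ Set.Icc a b, s ≤ t → lam * (t - s) ≤ f' t - f' s :=
    fun s hs t ht hst => (convex_Icc a b).mul_sub_le_image_sub_of_le_deriv hcf'
      (fun x hx => (hf' x (interior_subset hx)).differentiableAt.differentiableWithinAt)
      (fun x hx => by rw [(hf' x (interior_subset hx)).deriv]; exact h x (interior_subset hx))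
      s hs t ht hst
  -- The cut point is a zero of the increasing function `f'`, or an endpoint when `f'` keeps one
  -- sign; in the latter case one of the two pieces is degenerate.
  have hex : ∃ c ∈ Set.Icc a b, (c = b ∨ 0 ≤ f' c) ∧ (c = a ∨ f' c ≤ 0) := by
    by_cases ha : 0 ≤ f' a
    · exact ⟨a, ⟨le_rfl, hab⟩, Or.inr ha, Or.inl rfl⟩
    by_cases hb : f' b ≤ 0
    · exact ⟨b, ⟨hab, le_rfl⟩, Or.inl rfl, Or.inr hb⟩
    obtain ⟨c, hc, h0⟩ := intermediate_value_Icc hab hcf' ⟨(not_le.1 ha).le, (not_le.1 hb).le⟩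
    exact ⟨c, hc, Or.inr h0.ge, Or.inr h0.le⟩
  obtain ⟨c, hcm, hc1, hc2⟩ := hex
  have hsR : Set.Icc c b ⊆ Set.Icc a b := Set.Icc_subset_Icc_left hcm.1
  have hsL : Set.Icc a c ⊆ Set.Icc a b := Set.Icc_subset_Icc_right hcm.2
  have hce : ContinuousOn (fun t => Complex.exp (Complex.I * f t)) (Set.Icc a b) := by
    have : ContinuousOn f (Set.Icc a b) := fun t ht => (hf t ht).continuousAt.continuousWithinAt
    fun_prop
  have hR : ‖∫ t in c..b, Complex.exp (Complex.I * f t)‖ ≤ 3 / √lam := by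
    rcases hc1 with rfl | hc1
    · simp only [intervalIntegral.integral_same, norm_zero]; positivity
    refine norm_integral_cexp_le_of_linear_le_deriv hcm.2 (fun t ht => hf t (hsR ht))
      (fun t ht => hf' t (hsR ht)) (hc.mono hsR) (fun t ht => hlam.le.trans (h t (hsR ht))) hlam ?_
    intro t ht
    have := hgrow c hcm t (hsR ht) ht.1
    linarith
  have hL : ‖∫ t in a..c, Complex.exp (Complex.I * f t)‖ ≤ 3 / √lam := by
    rcases hc2 with rfl | hc2
    · simp only [intervalIntegral.integral_same, norm_zero]; positivity
    -- The left piece is reflected by `t ↦ -t`, which preserves the sign of the second derivative.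
    have hneg : ∀ t ∈ Set.Icc (-c) (-a), -t ∈ Set.Icc a c := fun t ht =>
      ⟨by linarith [ht.2], by linarith [ht.1]⟩
    have := norm_integral_cexp_le_of_linear_le_deriv (f := fun t => f (-t))
      (f' := fun t => -f' (-t)) (f'' := fun t => f'' (-t)) (c := -c) (b := -a) (lam := lam)
      (by linarith [hcm.1])
      (fun t ht => by
        exact ((hf (-t) (hsL (hneg t ht))).comp t (hasDerivAt_neg t)).congr_deriv (by ring))
      (fun t ht => by
        exact ((hf' (-t) (hsL (hneg t ht))).comp t (hasDerivAt_neg t)).neg.congr_deriv (by ring))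
      (hc.comp continuous_neg.continuousOn fun t ht => hsL (hneg t ht))
      (fun t ht => hlam.le.trans (h (-t) (hsL (hneg t ht)))) hlam
      (fun t ht => by
        have := hgrow (-t) (hsL (hneg t ht)) c hcm (hneg t ht).2
        linarith)
    have h3 := intervalIntegral.integral_comp_neg (a := -c) (b := -a)
      (fun t => Complex.exp (Complex.I * f t))
    rw [h3, neg_neg, neg_neg] at this
    exact this
  have hadd := intervalIntegral.integral_add_adjacent_intervals
      (ContinuousOn.intervalIntegrable_of_Icc (μ := MeasureTheory.volume) hcm.1 (hce.mono hsL))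
      (ContinuousOn.intervalIntegrable_of_Icc (μ := MeasureTheory.volume) hcm.2 (hce.mono hsR))
  rw [← hadd]
  calc _ ≤ 3 / √lam + 3 / √lam := (norm_add_le _ _).trans (add_le_add hL hR)
    _ = 6 / √lam := by ring

theorem norm_integral_cexp_le_of_le_abs_deriv2 {f f' f'' : ℝ → ℝ} {a b lam : ℝ} (hab : a ≤ b)
    (hf : ∀ t ∈ Set.Icc a b, HasDerivAt f (f' t) t)
    (hf' : ∀ t ∈ Set.Icc a b, HasDerivAt f' (f'' t) t)
    (hc : ContinuousOn f'' (Set.Icc a b)) (hlam : 0 < lam)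
    (h : (∀ t ∈ Set.Icc a b, lam ≤ f'' t) ∨ ∀ t ∈ Set.Icc a b, lam ≤ -f'' t) :
    ‖∫ t in a..b, Complex.exp (Complex.I * f t)‖ ≤ 6 / √lam := by
  rcases h with h | h
  · exact norm_integral_cexp_le_of_le_deriv2 hab hf hf' hc hlam h
  · have := norm_integral_cexp_le_of_le_deriv2 (f := fun t => -f t) (f' := fun t => -f' t)
      (f'' := fun t => -f'' t) hab (fun t ht => (hf t ht).neg) (fun t ht => (hf' t ht).neg)
      hc.neg hlam h
    have h2 : (∫ t in a..b, Complex.exp (Complex.I * ((-f t : ℝ) : ℂ)))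
        = starRingEnd ℂ (∫ t in a..b, Complex.exp (Complex.I * f t)) := by
      rw [← intervalIntegral.intervalIntegral_conj]
      congr 1
      funext t
      rw [← Complex.exp_conj]
      simp
    rwa [h2, Complex.norm_conj] at this

/-- Second-derivative van der Corput estimate with a decreasing amplitude. -/
theorem norm_integral_mul_cexp_le {f f' f'' g g' : ℝ → ℝ} {a b lam : ℝ} (hab : a ≤ b)
    (hf : ∀ t ∈ Set.Icc a b, HasDerivAt f (f' t) t)
    (hf' : ∀ t ∈ Set.Icc a b, HasDerivAt f' (f'' t) t)
    (hc : ContinuousOn f'' (Set.Icc a b)) (hlam : 0 < lam)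
    (h : (∀ t ∈ Set.Icc a b, lam ≤ f'' t) ∨ ∀ t ∈ Set.Icc a b, lam ≤ -f'' t)
    (hg : ∀ t ∈ Set.Icc a b, HasDerivAt g (g' t) t) (hg' : ∀ t ∈ Set.Icc a b, g' t ≤ 0)
    (hcg : ContinuousOn g' (Set.Icc a b)) (hg0 : 0 ≤ g b) :
    ‖∫ t in a..b, (g t : ℂ) * Complex.exp (Complex.I * f t)‖ ≤ 6 / √lam * g a := by
  have hce : ContinuousOn (fun t => Complex.exp (Complex.I * f t)) (Set.Icc a b) := by
    have : ContinuousOn f (Set.Icc a b) := fun t ht => (hf t ht).continuousAt.continuousWithinAt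
    fun_prop
  have hE : ∀ t ∈ Set.Icc a b,
      ‖∫ s in a..t, Complex.exp (Complex.I * f s)‖ ≤ 6 / √lam := by
    intro t ht
    have hs : Set.Icc a t ⊆ Set.Icc a b := Set.Icc_subset_Icc_right ht.2
    exact norm_integral_cexp_le_of_le_abs_deriv2 ht.1 (fun t ht => hf t (hs ht))
      (fun t ht => hf' t (hs ht)) (hc.mono hs) hlam
      (h.imp (fun h t ht => h t (hs ht)) (fun h t ht => h t (hs ht)))
  have hii := hce.intervalIntegrable_of_Icc (μ := MeasureTheory.volume) hab
  have hgi : IntervalIntegrable (fun t => (g' t : ℂ)) MeasureTheory.volume a b :=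
    (Complex.continuous_ofReal.comp_continuousOn hcg).intervalIntegrable_of_Icc hab
  have hgir := hcg.intervalIntegrable_of_Icc (μ := MeasureTheory.volume) hab
  have hparts := intervalIntegral.integral_mul_deriv_eq_deriv_mul_of_hasDerivAt
    (u := fun t => (g t : ℂ)) (u' := fun t => (g' t : ℂ))
    (v := fun t => ∫ s in a..t, Complex.exp (Complex.I * f s))
    (v' := fun t => Complex.exp (Complex.I * f t)) (a := a) (b := b)
    (Complex.continuous_ofReal.comp_continuousOn (by
      rw [Set.uIcc_of_le hab]
      exact fun t ht => (hg t ht).continuousAt.continuousWithinAt))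
    (by
      have := intervalIntegral.continuousOn_primitive_interval' hii Set.left_mem_uIcc
      exact this)
    (by
      intro t ht
      rw [min_eq_left hab, max_eq_right hab] at ht
      exact (hg t (Set.Ioo_subset_Icc_self ht)).ofReal_comp)
    (by
      intro t ht
      rw [min_eq_left hab, max_eq_right hab] at ht
      refine intervalIntegral.integral_hasDerivAt_right
        (hii.mono_set (by
          rw [Set.uIcc_of_le hab, Set.uIcc_of_le ht.1.le]
          exact Set.Icc_subset_Icc_right ht.2.le))
        ?_ ((hce t (Set.Ioo_subset_Icc_self ht)).continuousAt (Icc_mem_nhds ht.1 ht.2))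
      exact ContinuousOn.stronglyMeasurableAtFilter isOpen_Ioo
        (hce.mono Set.Ioo_subset_Icc_self) t ht)
    hgi hii
  rw [hparts]
  simp only [intervalIntegral.integral_same, mul_zero, sub_zero]
  -- As `g` is decreasing with `g b ≥ 0`, its end value plus its variation is exactly `g a`.
  have hga : ∫ t in a..b, g' t = g b - g a :=
    intervalIntegral.integral_eq_sub_of_hasDerivAt (by rwa [Set.uIcc_of_le hab]) hgir
  have h1 : ‖∫ t in a..b, (g' t : ℂ) * ∫ s in a..t, Complex.exp (Complex.I * f s)‖
      ≤ ∫ t in a..b, (-g' t) * (6 / √lam) := by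
    refine intervalIntegral.norm_integral_le_of_norm_le hab ?_ (hgir.neg.mul_const _)
    refine Filter.Eventually.of_forall fun t ht => ?_
    have ht' : t ∈ Set.Icc a b := ⟨ht.1.le, ht.2⟩
    rw [norm_mul, Complex.norm_real, Real.norm_of_nonpos (hg' t ht')]
    exact mul_le_mul_of_nonneg_left (hE t ht') (by linarith [hg' t ht'])
  rw [intervalIntegral.integral_mul_const, intervalIntegral.integral_neg, hga] at h1
  have h2 : ‖(g b : ℂ) * ∫ s in a..b, Complex.exp (Complex.I * f s)‖ ≤ g b * (6 / √lam) := by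
    rw [norm_mul, Complex.norm_real, Real.norm_of_nonneg hg0]
    exact mul_le_mul_of_nonneg_left (hE b ⟨hab, le_rfl⟩) hg0
  calc _ ≤ g b * (6 / √lam) + -(g b - g a) * (6 / √lam) :=
        (norm_sub_le _ _).trans (add_le_add h2 h1)
    _ = 6 / √lam * g a := by ring

/-! ### The limit profile: convergence, continuity, decay, nonvanishing at the origin -/

theorem attractorIntegrand_three_eq (b y u : ℝ) :
    attractorIntegrand 3 (Complex.I * b) y u
      = Complex.exp (Complex.I * ((-(y * u) - b * u ^ 3 : ℝ) : ℂ)) := by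
  rw [attractorIntegrand, ← Complex.exp_add]
  congr 1
  push_cast
  ring

theorem continuous_attractorIntegrand (m : ℕ) (β : ℂ) :
    Continuous fun p : ℝ × ℝ => attractorIntegrand m β p.1 p.2 := by
  unfold attractorIntegrand
  fun_prop

theorem continuous_attractorIntegrand_right (m : ℕ) (β : ℂ) (y : ℝ) :
    Continuous (attractorIntegrand m β y) := by
  unfold attractorIntegrand
  fun_prop

theorem attractorIntegrand_three_neg (b y u : ℝ) :
    attractorIntegrand 3 (Complex.I * b) y (-u)
      = starRingEnd ℂ (attractorIntegrand 3 (Complex.I * b) y u) := by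
  rw [attractorIntegrand_three_eq, attractorIntegrand_three_eq, ← Complex.exp_conj]
  congr 1
  simp only [map_mul, Complex.conj_I, Complex.conj_ofReal]
  push_cast
  ring

/-- The term `-yu` is linear and disappears from the second derivative of the phase, so the tail
bound is uniform in `y`. This uniformity underlies both continuity and decay of the profile. -/
theorem norm_integral_attractorIntegrand_le {b : ℝ} (hb : b ≠ 0) (y : ℝ) {M c d : ℝ} (hM : 0 < M)
    (hc : M ≤ c) (hd : M ≤ d) :
    ‖∫ u in c..d, attractorIntegrand 3 (Complex.I * b) y u‖ ≤ 6 / √(6 * |b| * M) := by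
  wlog hcd : c ≤ d generalizing c d
  · rw [intervalIntegral.integral_symm, norm_neg]
    exact this hd hc (le_of_not_ge hcd)
  simp_rw [attractorIntegrand_three_eq]
  have hlam : 0 < 6 * |b| * M := by have := abs_pos.2 hb; positivity
  refine norm_integral_cexp_le_of_le_abs_deriv2 (f := fun u => -(y * u) - b * u ^ 3)
    (f' := fun u => -y - b * (3 * u ^ 2)) (f'' := fun u => -(b * (6 * u))) hcd
    (fun t _ => ?_) (fun t _ => ?_) (by fun_prop) hlam ?_
  · refine (((hasDerivAt_id t).const_mul y).neg.sub ((hasDerivAt_pow 3 t).const_mul b)).congr_deriv ?_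
    simp
  · refine ((((hasDerivAt_pow 2 t).const_mul 3).const_mul b).const_sub (-y)).congr_deriv ?_
    norm_num
    left
    ring
  · rcases lt_or_gt_of_ne hb with h | h
    · left
      intro t ht
      rw [abs_of_neg h]
      nlinarith [ht.1]
    · right
      intro t ht
      rw [abs_of_pos h]
      nlinarith [ht.1]

theorem tendsto_six_div_sqrt {b : ℝ} (hb : b ≠ 0) :
    Tendsto (fun M : ℝ => 6 / √(6 * |b| * M)) atTop (𝓝 0) := by
  have hb' := abs_pos.2 hb
  exact tendsto_const_nhds.div_atTop
    (Real.tendsto_sqrt_atTop.comp (tendsto_id.const_mul_atTop (by positivity)))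

theorem exists_tendsto_half_integral {b : ℝ} (hb : b ≠ 0) (y : ℝ) :
    ∃ l : ℂ, Tendsto (fun R => ∫ u in (0 : ℝ)..R, attractorIntegrand 3 (Complex.I * b) y u)
      atTop (𝓝 l) := by
  have hi : ∀ c d, IntervalIntegrable (attractorIntegrand 3 (Complex.I * b) y)
      MeasureTheory.volume c d :=
    fun c d => (continuous_attractorIntegrand_right 3 _ y).intervalIntegrable c d
  refine cauchySeq_tendsto_of_complete (Metric.cauchySeq_iff.2 fun ε hε => ?_)
  obtain ⟨M, hM, hMpos⟩ := (((tendsto_six_div_sqrt hb).eventually (gt_mem_nhds hε)).and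
    (eventually_gt_atTop 0)).exists
  refine ⟨M, fun c hc d hd => ?_⟩
  rw [dist_comm, dist_eq_norm, intervalIntegral.integral_interval_sub_left (hi _ _) (hi _ _)]
  exact (norm_integral_attractorIntegrand_le hb y hMpos hc hd).trans_lt hM

theorem exists_hasImproperIntegral_attractorIntegrand {b : ℝ} (hb : b ≠ 0) (y : ℝ) :
    ∃ l : ℂ, HasImproperIntegral (attractorIntegrand 3 (Complex.I * b) y) l := by
  have hi : ∀ c d, IntervalIntegrable (attractorIntegrand 3 (Complex.I * b) y)
      MeasureTheory.volume c d :=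
    fun c d => (continuous_attractorIntegrand_right 3 _ y).intervalIntegrable c d
  obtain ⟨l, hl⟩ := exists_tendsto_half_integral hb y
  -- The integrand at `-u` is the conjugate of its value at `u`, so the left half-line contributes
  -- the conjugate of the right one.
  refine ⟨l + starRingEnd ℂ l, ?_⟩
  have h1 : Tendsto (fun p : ℝ × ℝ => starRingEnd ℂ
      (∫ u in (0 : ℝ)..(-p.1), attractorIntegrand 3 (Complex.I * b) y u)) (atBot ×ˢ atTop)
      (𝓝 (starRingEnd ℂ l)) :=
    (Complex.continuous_conj.tendsto l).comp
      (hl.comp (tendsto_neg_atBot_atTop.comp tendsto_fst))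
  have h2 := (hl.comp (tendsto_snd (f := (atBot : Filter ℝ)))).add h1
  refine h2.congr fun p => ?_
  rw [← intervalIntegral.intervalIntegral_conj]
  simp_rw [← attractorIntegrand_three_neg]
  rw [intervalIntegral.integral_comp_neg, neg_neg, neg_zero, add_comm]
  exact intervalIntegral.integral_add_adjacent_intervals (hi _ _) (hi _ _)

/-- The truncated oscillatory integral `∫_{-M}^M e^{-iyu} e^{-ibu³} du`. -/
noncomputable def truncIntegral (b M y : ℝ) : ℂ :=
  ∫ u in (-M)..M, attractorIntegrand 3 (Complex.I * b) y u

theorem norm_improperIntegral_sub_truncIntegral_le {b : ℝ} (hb : b ≠ 0) (y : ℝ) {M : ℝ}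
    (hM : 0 < M) :
    ‖improperIntegral (attractorIntegrand 3 (Complex.I * b) y) - truncIntegral b M y‖
      ≤ 2 * (6 / √(6 * |b| * M)) := by
  have hi : ∀ c d, IntervalIntegrable (attractorIntegrand 3 (Complex.I * b) y)
      MeasureTheory.volume c d :=
    fun c d => (continuous_attractorIntegrand_right 3 _ y).intervalIntegrable c d
  obtain ⟨l, hl⟩ := exists_hasImproperIntegral_attractorIntegrand hb y
  rw [hl.eq]
  refine le_of_tendsto ((Tendsto.sub_const hl (truncIntegral b M y)).norm) ?_
  have h1 : ∀ᶠ p : ℝ × ℝ in atBot ×ˢ atTop, p.1 ≤ -M := tendsto_fst.eventually (eventually_le_atBot _)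
  have h2 : ∀ᶠ p : ℝ × ℝ in (atBot : Filter ℝ) ×ˢ atTop, M ≤ p.2 :=
    tendsto_snd.eventually (eventually_ge_atTop _)
  filter_upwards [h1, h2] with p hp1 hp2
  have e : (∫ u in p.1..p.2, attractorIntegrand 3 (Complex.I * b) y u) - truncIntegral b M y
      = (∫ u in p.1..(-M), attractorIntegrand 3 (Complex.I * b) y u)
        + ∫ u in M..p.2, attractorIntegrand 3 (Complex.I * b) y u := by
    rw [truncIntegral, ← intervalIntegral.integral_add_adjacent_intervals (hi p.1 (-M)) (hi (-M) p.2),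
      ← intervalIntegral.integral_add_adjacent_intervals (hi (-M) M) (hi M p.2)]
    ring
  have h3 : ‖∫ u in p.1..(-M), attractorIntegrand 3 (Complex.I * b) y u‖
      ≤ 6 / √(6 * |b| * M) := by
    have := norm_integral_attractorIntegrand_le hb y hM le_rfl (show M ≤ -p.1 by linarith)
    rw [← Complex.norm_conj, ← intervalIntegral.intervalIntegral_conj] at this
    simp_rw [← attractorIntegrand_three_neg] at this
    rwa [intervalIntegral.integral_comp_neg, neg_neg] at this
  rw [e]
  linarith [norm_add_le (∫ u in p.1..(-M), attractorIntegrand 3 (Complex.I * b) y u)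
    (∫ u in M..p.2, attractorIntegrand 3 (Complex.I * b) y u),
    norm_integral_attractorIntegrand_le hb y hM le_rfl hp2]

theorem continuous_truncIntegral (b M : ℝ) : Continuous (truncIntegral b M) :=
  intervalIntegral.continuous_parametric_intervalIntegral_of_continuous'
    (continuous_attractorIntegrand 3 _) _ _

/-- This is the Riemann-Lebesgue lemma for the cut-off cubic exponential; `y` is rescaled by
`(2π)⁻¹` because the standard character is `e^{-2πiyu}`. -/
theorem tendsto_truncIntegral_cocompact (b : ℝ) {M : ℝ} (hM : 0 ≤ M) :
    Tendsto (truncIntegral b M) (cocompact ℝ) (𝓝 0) := by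
  have h := Real.tendsto_integral_exp_smul_cocompact
    ((Set.Ioc (-M) M).indicator (attractorIntegrand 3 (Complex.I * b) 0))
  have hpi : (2 * Real.pi)⁻¹ ≠ 0 := by positivity
  have h2 := h.comp (Homeomorph.mulLeft₀ _ hpi).isClosedEmbedding.tendsto_cocompact
  refine h2.congr fun y => ?_
  simp only [Function.comp, Homeomorph.coe_mulLeft₀]
  rw [truncIntegral, intervalIntegral.integral_of_le (by linarith),
    ← MeasureTheory.integral_indicator measurableSet_Ioc]
  congr 1
  funext u
  by_cases hu : u ∈ Set.Ioc (-M) M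
  · rw [Set.indicator_of_mem hu, Set.indicator_of_mem hu, Circle.smul_def, Real.fourierChar_apply,
      smul_eq_mul, attractorIntegrand_three_eq, attractorIntegrand_three_eq, ← Complex.exp_add]
    congr 1
    push_cast
    field_simp
    ring
  · simp [Set.indicator_of_notMem hu]

theorem tendstoUniformly_truncIntegral {b : ℝ} (hb : b ≠ 0) :
    TendstoUniformly (fun M y => truncIntegral b M y)
      (fun y => improperIntegral (attractorIntegrand 3 (Complex.I * b) y)) atTop := by
  rw [Metric.tendstoUniformly_iff]
  intro ε hε
  have h := (tendsto_six_div_sqrt hb).const_mul 2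
  rw [mul_zero] at h
  filter_upwards [h.eventually (gt_mem_nhds hε), eventually_gt_atTop 0] with M hM hM0 y
  rw [dist_eq_norm]
  exact (norm_improperIntegral_sub_truncIntegral_le hb y hM0).trans_lt hM

theorem continuous_attractor_three {b : ℝ} (hb : b ≠ 0) :
    Continuous (attractor 3 (Complex.I * b)) := by
  unfold attractor
  exact continuous_const.mul ((tendstoUniformly_truncIntegral hb).continuous
    (Frequently.of_forall fun M => continuous_truncIntegral b M))

theorem tendsto_attractor_three_cocompact {b : ℝ} (hb : b ≠ 0) :
    Tendsto (attractor 3 (Complex.I * b)) (cocompact ℝ) (𝓝 0) := by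
  have : Tendsto (fun y => improperIntegral (attractorIntegrand 3 (Complex.I * b) y))
      (cocompact ℝ) (𝓝 0) := by
    rw [Metric.tendsto_nhds]
    intro ε hε
    obtain ⟨M, hM, hM0⟩ := (((Metric.tendstoUniformly_iff.1 (tendstoUniformly_truncIntegral hb))
      (ε / 2) (half_pos hε)).and (eventually_ge_atTop 0)).exists
    filter_upwards [(Metric.tendsto_nhds.1 (tendsto_truncIntegral_cocompact b hM0)) (ε / 2)
      (half_pos hε)] with y hy
    linarith [dist_triangle (improperIntegral (attractorIntegrand 3 (Complex.I * b) y))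
      (truncIntegral b M y) 0, hM y]
  have h := this.const_mul (1 / (2 * (Real.pi : ℂ)))
  rwa [mul_zero] at h

/-- An integration-by-parts lower bound for the Fresnel-type integral of `cos (b u³)`. -/
theorem integral_cos_cube_ge {b R₀ R : ℝ} (hb : 0 < b) (hR₀ : b * R₀ ^ 3 = 1) (hR : R₀ ≤ R) :
    R₀ / 18 - (1 / (3 * b * R ^ 2) + 4 / (9 * b ^ 2 * R ^ 5)) ≤
      ∫ u in (0 : ℝ)..R, Real.cos (b * u ^ 3) := by
  have hR₀0 : 0 < R₀ := by
    by_contra h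
    have : R₀ ^ 3 ≤ 0 := by
      have h2 : R₀ ^ 3 = R₀ * R₀ ^ 2 := by ring
      rw [h2]
      exact mul_nonpos_of_nonpos_of_nonneg (not_lt.1 h) (sq_nonneg _)
    nlinarith
  -- `P` collects the boundary terms of two integrations by parts. Taking `1 - cos` rather than
  -- `-cos` as primitive of `sin` makes the remaining integrand nonnegative, whence the monotonicity
  -- below.
  set P : ℝ → ℝ := fun u => Real.sin (b * u ^ 3) * (3 * b * u ^ 2)⁻¹
    + (1 - Real.cos (b * u ^ 3)) * (9 * b ^ 2 / 2 * u ^ 5)⁻¹ with hP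
  have hcos : Continuous fun u : ℝ => Real.cos (b * u ^ 3) := by fun_prop
  have hmono : MonotoneOn (fun R => (∫ u in (0 : ℝ)..R, Real.cos (b * u ^ 3)) - P R)
      (Set.Ici R₀) := by
    have hd : ∀ u : ℝ, 0 < u → HasDerivAt
        (fun R => (∫ u in (0 : ℝ)..R, Real.cos (b * u ^ 3)) - P R)
        (10 / (9 * b ^ 2) * (1 - Real.cos (b * u ^ 3)) / u ^ 6) u := by
      intro u hu
      have h0 : HasDerivAt (fun u : ℝ => b * u ^ 3) (b * (3 * u ^ 2)) u := by
        simpa using (hasDerivAt_pow 3 u).const_mul b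
      have h1 : HasDerivAt (fun u : ℝ => (3 * b * u ^ 2)⁻¹)
          (-(3 * b * (2 * u)) / (3 * b * u ^ 2) ^ 2) u := by
        have := ((hasDerivAt_pow 2 u).const_mul (3 * b)).fun_inv (by positivity)
        simpa using this
      have h2 : HasDerivAt (fun u : ℝ => (9 * b ^ 2 / 2 * u ^ 5)⁻¹)
          (-(9 * b ^ 2 / 2 * (5 * u ^ 4)) / (9 * b ^ 2 / 2 * u ^ 5) ^ 2) u := by
        have := ((hasDerivAt_pow 5 u).const_mul (9 * b ^ 2 / 2)).fun_inv (by positivity)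
        simpa using this
      have h3 := (h0.sin.fun_mul h1).fun_add ((h0.cos.const_sub 1).fun_mul h2)
      have h4 := intervalIntegral.integral_hasDerivAt_right (hcos.intervalIntegrable 0 u)
        (hcos.stronglyMeasurableAtFilter _ _) hcos.continuousAt
      refine (h4.sub h3).congr_deriv ?_
      field_simp
      ring
    refine monotoneOn_of_deriv_nonneg (convex_Ici _)
      (fun u hu => (hd u (hR₀0.trans_le hu)).continuousAt.continuousWithinAt)
      (fun u hu => (hd u (hR₀0.trans_le (interior_subset hu))).differentiableAt.differentiableWithinAt)
      (fun u hu => ?_)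
    have hu0 : 0 < u := hR₀0.trans_le (interior_subset hu)
    rw [(hd u hu0).deriv]
    have := Real.cos_le_one (b * u ^ 3)
    have : 0 ≤ 1 - Real.cos (b * u ^ 3) := by linarith
    positivity
  have h := hmono (Set.mem_Ici.2 le_rfl) (Set.mem_Ici.2 hR) hR
  simp only at h
  have hc1 : 1 / 2 ≤ Real.cos 1 := by
    have := Real.one_sub_sq_div_two_le_cos (x := 1)
    linarith
  have hI : R₀ * Real.cos 1 ≤ ∫ u in (0 : ℝ)..R₀, Real.cos (b * u ^ 3) := by
    have := intervalIntegral.integral_mono_on (a := 0) (b := R₀) (f := fun _ => Real.cos 1)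
      (g := fun u => Real.cos (b * u ^ 3)) (μ := MeasureTheory.volume) hR₀0.le
      (intervalIntegrable_const) (hcos.intervalIntegrable _ _) (fun u hu => by
        have h1 : b * u ^ 3 ≤ 1 := by
          rw [← hR₀]; have := hu.1; have := hu.2; gcongr
        exact Real.cos_le_cos_of_nonneg_of_le_pi (by have := hu.1; positivity)
          (by linarith [Real.pi_gt_three]) h1)
    simpa using this
  -- At `R₀` the phase equals `1`, and `sin 1 ≤ 1`, `cos 1 ≥ 1/2` give `1/3 + 1/9 = 4/9`. Against
  -- `∫₀^{R₀} cos ≥ R₀/2` this leaves the margin `R₀/18`.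
  have hP0 : P R₀ ≤ 4 / 9 * R₀ := by
    have hs : Real.sin 1 ≤ 1 := Real.sin_le_one 1
    have hbv : b = (R₀ ^ 3)⁻¹ := eq_inv_of_mul_eq_one_left hR₀
    simp only [hP]
    rw [hR₀, hbv]
    have e : Real.sin 1 * (3 * (R₀ ^ 3)⁻¹ * R₀ ^ 2)⁻¹
        + (1 - Real.cos 1) * (9 * (R₀ ^ 3)⁻¹ ^ 2 / 2 * R₀ ^ 5)⁻¹
        = R₀ * (Real.sin 1 / 3 + 2 / 9 * (1 - Real.cos 1)) := by
      field_simp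
    rw [e]
    nlinarith
  have hPR : -(1 / (3 * b * R ^ 2) + 4 / (9 * b ^ 2 * R ^ 5)) ≤ P R := by
    have hR0 : 0 < R := hR₀0.trans_le hR
    have h1 : -1 * (3 * b * R ^ 2)⁻¹ ≤ Real.sin (b * R ^ 3) * (3 * b * R ^ 2)⁻¹ := by
      gcongr
      exact Real.neg_one_le_sin _
    have h2 : 0 ≤ (1 - Real.cos (b * R ^ 3)) * (9 * b ^ 2 / 2 * R ^ 5)⁻¹ := by
      have := Real.cos_le_one (b * R ^ 3)
      have : 0 ≤ 1 - Real.cos (b * R ^ 3) := by linarith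
      positivity
    have h3 : 0 ≤ 4 / (9 * b ^ 2 * R ^ 5) := by positivity
    have h4 : 1 / (3 * b * R ^ 2) = (3 * b * R ^ 2)⁻¹ := one_div _
    simp only [hP]
    linarith
  nlinarith

theorem truncIntegral_zero_re (b M : ℝ) :
    (truncIntegral b M 0).re = 2 * ∫ u in (0 : ℝ)..M, Real.cos (|b| * u ^ 3) := by
  have hcos : Continuous fun u : ℝ => Real.cos (|b| * u ^ 3) := by fun_prop
  have h1 : (truncIntegral b M 0).re = ∫ u in (-M)..M, Real.cos (|b| * u ^ 3) := by
    have := intervalIntegral.intervalIntegral_re (𝕜 := ℂ)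
      ((continuous_attractorIntegrand_right 3 (Complex.I * b) 0).intervalIntegrable
        (μ := MeasureTheory.volume) (-M) M)
    rw [truncIntegral]
    refine this.symm.trans ?_
    congr 1
    funext u
    rw [attractorIntegrand_three_eq, mul_comm]
    simp only [RCLike.re_to_complex, Complex.exp_ofReal_mul_I_re]
    rw [← Real.cos_abs, ← Real.cos_abs (|b| * u ^ 3)]
    congr 1
    simp [abs_mul]
  rw [h1, ← intervalIntegral.integral_add_adjacent_intervals (hcos.intervalIntegrable (-M) 0)
    (hcos.intervalIntegrable 0 M)]
  have h2 := intervalIntegral.integral_comp_neg (a := 0) (b := M)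
    (fun u => Real.cos (|b| * u ^ 3))
  rw [neg_zero] at h2
  rw [← h2]
  have h3 : ∀ u : ℝ, Real.cos (|b| * (-u) ^ 3) = Real.cos (|b| * u ^ 3) := by
    intro u
    rw [← Real.cos_neg]
    congr 1
    ring
  simp_rw [h3]
  ring

/-- Letting `R → ∞` in `integral_cos_cube_ge`, the correction terms vanish and the real part of the
integral is at least `R₀/9 > 0`. -/
theorem attractor_three_zero_ne_zero {b : ℝ} (hb : b ≠ 0) :
    attractor 3 (Complex.I * b) 0 ≠ 0 := by
  have hb' := abs_pos.2 hb
  set R₀ : ℝ := (|b|⁻¹) ^ ((3 : ℝ)⁻¹) with hR₀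
  have hR₀p : 0 < R₀ := by positivity
  have hR₀3 : |b| * R₀ ^ 3 = 1 := by
    have : R₀ ^ 3 = |b|⁻¹ := by
      rw [hR₀]
      exact_mod_cast Real.rpow_inv_natCast_pow (n := 3) (by positivity : 0 ≤ |b|⁻¹) (by norm_num)
    rw [this, mul_inv_cancel₀ hb'.ne']
  have hlim : Tendsto (fun R : ℝ => 2 * (R₀ / 18 - (1 / (3 * |b| * R ^ 2)
      + 4 / (9 * |b| ^ 2 * R ^ 5)))) atTop (𝓝 (2 * (R₀ / 18 - (0 + 0)))) := by
    refine Tendsto.const_mul _ (Tendsto.const_sub _ (Tendsto.add ?_ ?_))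
    · exact tendsto_const_nhds.div_atTop
        ((tendsto_pow_atTop (by norm_num)).const_mul_atTop (by positivity))
    · exact tendsto_const_nhds.div_atTop
        ((tendsto_pow_atTop (by norm_num)).const_mul_atTop (by positivity))
  have hT : Tendsto (fun M => (truncIntegral b M 0).re) atTop
      (𝓝 (improperIntegral (attractorIntegrand 3 (Complex.I * b) 0)).re) :=
    (Complex.continuous_re.tendsto _).comp ((tendstoUniformly_truncIntegral hb).tendsto_at 0)
  have hle := le_of_tendsto_of_tendsto hlim hT (by
    filter_upwards [eventually_ge_atTop R₀] with R hR
    rw [truncIntegral_zero_re]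
    have := integral_cos_cube_ge hb' hR₀3 hR
    linarith)
  have hne : improperIntegral (attractorIntegrand 3 (Complex.I * b) 0) ≠ 0 := by
    intro h
    rw [h, Complex.zero_re] at hle
    linarith
  rw [attractor]
  exact mul_ne_zero (by simp [Real.pi_ne_zero]) hne

/-! ### The normalised symbol: modulus, phase, and behaviour near zero -/

/-- The normalised Fourier symbol `1 - α²(1 - cos ξ) + iα sin ξ`. -/
noncomputable def laxSymbol (α ξ : ℝ) : ℂ :=
  ((1 - α ^ 2 * (1 - Real.cos ξ) : ℝ) : ℂ) + ((α * Real.sin ξ : ℝ) : ℂ) * Complex.I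

/-- The squared modulus of `laxSymbol`. -/
noncomputable def laxNormSq (α ξ : ℝ) : ℝ := 1 - α ^ 2 * (1 - α ^ 2) * (1 - Real.cos ξ) ^ 2

theorem continuous_laxSymbol (α : ℝ) : Continuous (laxSymbol α) := by
  unfold laxSymbol
  fun_prop

theorem laxSymbol_re (α ξ : ℝ) : (laxSymbol α ξ).re = 1 - α ^ 2 * (1 - Real.cos ξ) := by
  simp [laxSymbol, -Complex.ofReal_mul, -Complex.ofReal_sub, -Complex.ofReal_sin]

theorem laxSymbol_im (α ξ : ℝ) : (laxSymbol α ξ).im = α * Real.sin ξ := by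
  simp [laxSymbol, -Complex.ofReal_mul, -Complex.ofReal_sub, -Complex.ofReal_sin]

theorem normSq_laxSymbol (α ξ : ℝ) : Complex.normSq (laxSymbol α ξ) = laxNormSq α ξ := by
  rw [Complex.normSq_apply, laxSymbol_re, laxSymbol_im, laxNormSq]
  have := Real.sin_sq_add_cos_sq ξ
  linear_combination α ^ 2 * this

theorem norm_laxSymbol (α ξ : ℝ) : ‖laxSymbol α ξ‖ = √(laxNormSq α ξ) := by
  rw [← normSq_laxSymbol]
  rfl

theorem laxNormSq_le_one {α : ℝ} (h1 : α ^ 2 < 1) (ξ : ℝ) : laxNormSq α ξ ≤ 1 := by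
  have : 0 ≤ α ^ 2 * (1 - α ^ 2) * (1 - Real.cos ξ) ^ 2 := by
    have : 0 ≤ 1 - α ^ 2 := by linarith
    positivity
  rw [laxNormSq]
  linarith

theorem norm_laxSymbol_le_one {α : ℝ} (h1 : α ^ 2 < 1) (ξ : ℝ) : ‖laxSymbol α ξ‖ ≤ 1 := by
  rw [norm_laxSymbol]
  exact Real.sqrt_le_one.2 (laxNormSq_le_one h1 ξ)

theorem laxSymbol_neg (α ξ : ℝ) : laxSymbol α (-ξ) = starRingEnd ℂ (laxSymbol α ξ) := by
  apply Complex.ext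
  · rw [Complex.conj_re, laxSymbol_re, laxSymbol_re, Real.cos_neg]
  · rw [Complex.conj_im, laxSymbol_im, laxSymbol_im, Real.sin_neg, mul_neg]

theorem hasDerivAt_laxSymbol (α ξ : ℝ) : HasDerivAt (laxSymbol α)
    (((-(α ^ 2 * Real.sin ξ) : ℝ) : ℂ) + ((α * Real.cos ξ : ℝ) : ℂ) * Complex.I) ξ := by
  have h1 : HasDerivAt (fun ξ => 1 - α ^ 2 * (1 - Real.cos ξ)) (-(α ^ 2 * Real.sin ξ)) ξ :=
    ((((Real.hasDerivAt_cos ξ).const_sub 1).const_mul (α ^ 2)).const_sub 1).congr_deriv (by ring)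
  have h2 : HasDerivAt (fun ξ => α * Real.sin ξ) (α * Real.cos ξ) ξ :=
    (Real.hasDerivAt_sin ξ).const_mul α
  exact h1.ofReal_comp.add (h2.ofReal_comp.mul_const Complex.I)

theorem hasDerivAt_laxNormSq (α ξ : ℝ) : HasDerivAt (laxNormSq α)
    (-(2 * α ^ 2 * (1 - α ^ 2) * (1 - Real.cos ξ) * Real.sin ξ)) ξ :=
  (((((Real.hasDerivAt_cos ξ).const_sub 1).pow 2).const_mul (α ^ 2 * (1 - α ^ 2))).const_sub
    1).congr_deriv (by norm_num; ring)

theorem one_sub_cos_mem {ξ : ℝ} (hξ : ξ ∈ Set.Icc (0 : ℝ) (1 / 2)) :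
    0 ≤ 1 - Real.cos ξ ∧ 1 - Real.cos ξ ≤ 1 / 8 := by
  have := Real.one_sub_sq_div_two_le_cos (x := ξ)
  have := Real.cos_le_one ξ
  constructor
  · linarith
  · nlinarith [hξ.1, hξ.2]

theorem laxNormSq_pos {α ξ : ℝ} (h1 : α ^ 2 < 1) (hξ : ξ ∈ Set.Icc (0 : ℝ) (1 / 2)) :
    0 < laxNormSq α ξ := by
  obtain ⟨ha, hb⟩ := one_sub_cos_mem hξ
  have h2 : α ^ 2 * (1 - α ^ 2) ≤ 1 := by nlinarith [sq_nonneg α]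
  have h3 : (1 - Real.cos ξ) ^ 2 ≤ 1 / 8 := by nlinarith
  have h4 : α ^ 2 * (1 - α ^ 2) * (1 - Real.cos ξ) ^ 2 ≤ 1 * (1 / 8) :=
    mul_le_mul h2 h3 (sq_nonneg _) zero_le_one
  rw [laxNormSq]
  linarith

/-- The derivative of the argument of `laxSymbol`. -/
noncomputable def laxPhaseDeriv (α ξ : ℝ) : ℝ :=
  α * ((1 - α ^ 2) * Real.cos ξ + α ^ 2) / laxNormSq α ξ

/-- The second derivative of the argument of `laxSymbol`. -/
noncomputable def laxPhaseDeriv2 (α ξ : ℝ) : ℝ :=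
  -(α * (1 - α ^ 2) * (1 - 2 * α ^ 2 * (1 - Real.cos ξ)
    + α ^ 2 * (1 - α ^ 2) * (1 - Real.cos ξ) ^ 2) * Real.sin ξ) / laxNormSq α ξ ^ 2

theorem hasDerivAt_arg_laxSymbol {α ξ : ℝ} (h1 : α ^ 2 < 1) (hξ : ξ ∈ Set.Icc (0 : ℝ) (1 / 2)) :
    HasDerivAt (fun ξ => Complex.arg (laxSymbol α ξ)) (laxPhaseDeriv α ξ) ξ := by
  obtain ⟨ha, hb⟩ := one_sub_cos_mem hξ
  have hs : laxSymbol α ξ ∈ Complex.slitPlane := by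
    left
    rw [laxSymbol_re]
    nlinarith [sq_nonneg α]
  have h := (hasDerivAt_laxSymbol α ξ).clog_real hs
  have h2 := Complex.imCLM.hasFDerivAt.comp_hasDerivAt ξ h
  refine (h2.congr_of_eventuallyEq
    (Eventually.of_forall fun t => (Complex.log_im _).symm)).congr_deriv ?_
  have := Real.sin_sq_add_cos_sq ξ
  rw [Complex.imCLM_apply, Complex.div_im, normSq_laxSymbol, laxSymbol_re, laxSymbol_im,
    laxPhaseDeriv, ← sub_div]
  simp only [Complex.add_im, Complex.ofReal_im, Complex.mul_im, Complex.I_re, Complex.I_im,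
    Complex.ofReal_re, Complex.add_re, Complex.mul_re, mul_zero, mul_one, zero_add, add_zero,
    sub_zero]
  congr 1
  linear_combination α ^ 3 * this

theorem hasDerivAt_laxPhaseDeriv {α ξ : ℝ} (h1 : α ^ 2 < 1)
    (hξ : ξ ∈ Set.Icc (0 : ℝ) (1 / 2)) :
    HasDerivAt (laxPhaseDeriv α) (laxPhaseDeriv2 α ξ) ξ := by
  have hq := laxNormSq_pos h1 hξ
  have hn := (((Real.hasDerivAt_cos ξ).const_mul (1 - α ^ 2)).add_const (α ^ 2)).const_mul α
  refine (hn.fun_div (hasDerivAt_laxNormSq α ξ) hq.ne').congr_deriv ?_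
  rw [laxPhaseDeriv2]
  congr 1
  rw [laxNormSq]
  ring

theorem continuousOn_laxPhaseDeriv2 {α : ℝ} (h1 : α ^ 2 < 1) :
    ContinuousOn (laxPhaseDeriv2 α) (Set.Icc (0 : ℝ) (1 / 2)) := by
  unfold laxPhaseDeriv2
  refine ContinuousOn.div (by fun_prop) ?_ fun ξ hξ => (pow_pos (laxNormSq_pos h1 hξ) 2).ne'
  unfold laxNormSq
  fun_prop

/-- The form `-α * m` records that the second derivative of the phase has constant sign, opposite to
that of `α`. The bound combines Jordan's inequality `sin ξ ≥ ξ/2`, the middle factor being at least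
`1/2`, and a denominator at most `1`. -/
theorem exists_laxPhaseDeriv2_eq {α ξ : ℝ} (h1 : α ^ 2 < 1) (hξ : ξ ∈ Set.Icc (0 : ℝ) (1 / 2)) :
    ∃ m : ℝ, (1 - α ^ 2) * ξ / 4 ≤ m ∧ laxPhaseDeriv2 α ξ = -α * m := by
  obtain ⟨ha, hb⟩ := one_sub_cos_mem hξ
  have hq := laxNormSq_pos h1 hξ
  have hq1 := laxNormSq_le_one h1 ξ
  refine ⟨(1 - α ^ 2) * ((1 - 2 * α ^ 2 * (1 - Real.cos ξ)
    + α ^ 2 * (1 - α ^ 2) * (1 - Real.cos ξ) ^ 2) * Real.sin ξ) / laxNormSq α ξ ^ 2, ?_, ?_⟩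
  · have hk : 0 < 1 - α ^ 2 := by linarith
    have hsin : ξ / 2 ≤ Real.sin ξ := by
      have h := Real.mul_le_sin hξ.1 (by linarith [hξ.2, Real.pi_gt_three])
      refine le_trans ?_ h
      rw [div_eq_inv_mul]
      have : (2 : ℝ)⁻¹ ≤ 2 / Real.pi := by
        rw [le_div_iff₀ Real.pi_pos]
        linarith [Real.pi_le_four]
      exact mul_le_mul_of_nonneg_right this hξ.1
    have hfac : 1 / 2 ≤ 1 - 2 * α ^ 2 * (1 - Real.cos ξ)
        + α ^ 2 * (1 - α ^ 2) * (1 - Real.cos ξ) ^ 2 := by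
      have : 0 ≤ α ^ 2 * (1 - α ^ 2) * (1 - Real.cos ξ) ^ 2 := by positivity
      nlinarith [sq_nonneg α]
    rw [le_div_iff₀ (by positivity)]
    have hξ0 := hξ.1
    calc (1 - α ^ 2) * ξ / 4 * laxNormSq α ξ ^ 2 ≤ (1 - α ^ 2) * ξ / 4 * 1 :=
          mul_le_mul_of_nonneg_left (pow_le_one₀ hq.le hq1) (by positivity)
      _ = (1 - α ^ 2) * (1 / 2 * (ξ / 2)) := by ring
      _ ≤ _ := by gcongr
  · rw [laxPhaseDeriv2]
    ring

/-- In polar form the amplitude `|p|^n` decreases on `[0, 1/2]`, and `x` enters the phase only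
linearly; hence the second-derivative estimate with amplitude yields a bound independent of `x`. -/
theorem norm_integral_laxSymbol_near_le {α : ℝ} (h0 : α ≠ 0) (h1 : α ^ 2 < 1) {n : ℕ} (hn : 0 < n)
    (x : ℝ) {c d : ℝ} (hc : 0 < c) (hcd : c ≤ d) (hd : d ≤ 1 / 2) :
    ‖∫ ξ in c..d, laxSymbol α ξ ^ n * Complex.exp (-(Complex.I * x * ξ))‖
      ≤ 6 / √(n * |α| * (1 - α ^ 2) * c / 4) := by
  have hk : 0 < 1 - α ^ 2 := by linarith
  have hn' : (0 : ℝ) < n := by exact_mod_cast hn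
  have hα := abs_pos.2 h0
  have hsub : Set.Icc c d ⊆ Set.Icc 0 (1 / 2) := Set.Icc_subset_Icc hc.le hd
  have heq : ∀ ξ : ℝ, laxSymbol α ξ ^ n * Complex.exp (-(Complex.I * x * ξ))
      = ((√(laxNormSq α ξ) ^ n : ℝ) : ℂ)
        * Complex.exp (Complex.I * ((n * Complex.arg (laxSymbol α ξ) - x * ξ : ℝ) : ℂ)) := by
    intro ξ
    conv_lhs => rw [← Complex.norm_mul_exp_arg_mul_I (laxSymbol α ξ)]
    rw [norm_laxSymbol, mul_pow, ← Complex.exp_nat_mul, mul_assoc, ← Complex.exp_add]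
    push_cast
    congr 2
    ring
  simp_rw [heq]
  have hlam : 0 < n * |α| * (1 - α ^ 2) * c / 4 := by positivity
  have key := norm_integral_mul_cexp_le (f := fun ξ => n * Complex.arg (laxSymbol α ξ) - x * ξ)
    (f' := fun ξ => n * laxPhaseDeriv α ξ - x) (f'' := fun ξ => n * laxPhaseDeriv2 α ξ)
    (g := fun ξ => √(laxNormSq α ξ) ^ n)
    (g' := fun ξ => n * √(laxNormSq α ξ) ^ (n - 1) *
      (-(2 * α ^ 2 * (1 - α ^ 2) * (1 - Real.cos ξ) * Real.sin ξ) / (2 * √(laxNormSq α ξ))))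
    hcd
    (fun t ht => (((hasDerivAt_arg_laxSymbol h1 (hsub ht)).const_mul (n : ℝ)).sub
      ((hasDerivAt_id t).const_mul x)).congr_deriv (by rw [mul_one]))
    (fun t ht => ((hasDerivAt_laxPhaseDeriv h1 (hsub ht)).const_mul (n : ℝ)).sub_const x)
    (((continuousOn_laxPhaseDeriv2 h1).mono hsub).const_smul (n : ℝ)) hlam
    (by
      rcases lt_or_gt_of_ne h0 with h | h
      · left
        intro t ht
        obtain ⟨m, hm, he⟩ := exists_laxPhaseDeriv2_eq h1 (hsub ht)
        rw [he, abs_of_neg h]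
        have : (1 - α ^ 2) * c / 4 ≤ m := by
          refine le_trans ?_ hm; have := ht.1; gcongr
        calc _ = n * (-α * ((1 - α ^ 2) * c / 4)) := by ring
          _ ≤ _ := by have : 0 < -α := by linarith
                      gcongr
      · right
        intro t ht
        obtain ⟨m, hm, he⟩ := exists_laxPhaseDeriv2_eq h1 (hsub ht)
        rw [he, abs_of_pos h]
        have : (1 - α ^ 2) * c / 4 ≤ m := by
          refine le_trans ?_ hm; have := ht.1; gcongr
        calc _ = n * (α * ((1 - α ^ 2) * c / 4)) := by ring
          _ ≤ n * (α * m) := by gcongr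
          _ = _ := by ring)
    (fun t ht => (((hasDerivAt_laxNormSq α t).sqrt (laxNormSq_pos h1 (hsub ht)).ne').fun_pow n))
    (fun t ht => by
      have h2 := (one_sub_cos_mem (hsub ht)).1
      have h3 : 0 ≤ Real.sin t := Real.sin_nonneg_of_nonneg_of_le_pi (hsub ht).1
        (by linarith [(hsub ht).2, Real.pi_gt_three])
      rw [neg_div, mul_neg, neg_nonpos]
      positivity)
    (by
      have hcq : Continuous (laxNormSq α) := by unfold laxNormSq; fun_prop
      refine ContinuousOn.mul (by fun_prop) (ContinuousOn.div (by fun_prop) (by fun_prop) ?_)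
      intro t ht
      have := Real.sqrt_pos.2 (laxNormSq_pos h1 (hsub ht))
      positivity)
    (by positivity)
  refine key.trans ?_
  have : √(laxNormSq α c) ^ n ≤ 1 :=
    pow_le_one₀ (Real.sqrt_nonneg _) (Real.sqrt_le_one.2 (laxNormSq_le_one h1 c))
  exact mul_le_of_le_one_right (by positivity) this

theorem exists_norm_laxSymbol_le {α : ℝ} (h0 : α ≠ 0) (h1 : α ^ 2 < 1) :
    ∃ r : ℝ, 0 ≤ r ∧ r < 1 ∧ ∀ ξ ∈ Set.Icc (1 / 2 : ℝ) Real.pi, ‖laxSymbol α ξ‖ ≤ r := by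
  -- The modulus decreases on `[0, π]`, so its value at `1/2` dominates.
  refine ⟨√(laxNormSq α (1 / 2)), Real.sqrt_nonneg _, ?_, fun ξ hξ => ?_⟩
  · rw [Real.sqrt_lt' one_pos, one_pow, laxNormSq]
    have hk : 0 < 1 - α ^ 2 := by linarith
    have hc : Real.cos (1 / 2) < 1 := by
      have := Real.cos_lt_cos_of_nonneg_of_le_pi le_rfl
        (by linarith [Real.pi_gt_three] : (1 / 2 : ℝ) ≤ Real.pi) (by norm_num)
      simpa using this
    have hc' : 0 < 1 - Real.cos (1 / 2) := by linarith
    have : 0 < α ^ 2 * (1 - α ^ 2) * (1 - Real.cos (1 / 2)) ^ 2 := by positivity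
    linarith
  · rw [norm_laxSymbol]
    refine Real.sqrt_le_sqrt ?_
    rw [laxNormSq, laxNormSq]
    have hk : 0 < 1 - α ^ 2 := by linarith
    have h2 : Real.cos ξ ≤ Real.cos (1 / 2) :=
      Real.cos_le_cos_of_nonneg_of_le_pi (by norm_num) hξ.2 hξ.1
    have h3 : 0 ≤ 1 - Real.cos (1 / 2) := by linarith [Real.cos_le_one (1 / 2)]
    gcongr

/-- The coefficient `(α - α³)/6` is the one that cancels the cubic terms of the imaginary part; the
quadratic terms of the real part cancel because the coefficient of `1 - cos ξ` is `α²`. The constant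
`21` is a crude sum of Taylor remainders. -/
theorem norm_laxSymbol_sub_cexp_le {α : ℝ} (h1 : α ^ 2 < 1) {ξ : ℝ} (hξ : |ξ| ≤ 1 / 2) :
    ‖laxSymbol α ξ - Complex.exp (Complex.I * ((α * ξ - (α - α ^ 3) / 6 * ξ ^ 3 : ℝ) : ℂ))‖
      ≤ 21 * ξ ^ 4 := by
  have hα : |α| ≤ 1 := by rw [← sq_le_one_iff_abs_le_one]; exact h1.le
  have hb : |(α - α ^ 3) / 6| ≤ 1 / 6 := by
    have e : (α - α ^ 3) / 6 = α * (1 - α ^ 2) / 6 := by ring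
    rw [e, abs_div, abs_mul, abs_of_pos (by linarith : 0 < 1 - α ^ 2),
      abs_of_pos (by norm_num : (0 : ℝ) < 6)]
    have := mul_le_mul hα (by nlinarith [sq_nonneg α] : 1 - α ^ 2 ≤ 1) (by linarith) zero_le_one
    linarith
  set b := (α - α ^ 3) / 6 with hbdef
  set v := α * ξ - b * ξ ^ 3 with hv
  have hξ2 : ξ ^ 2 ≤ 1 / 4 := by rw [← sq_abs]; nlinarith [abs_nonneg ξ]
  have hp : 0 ≤ ξ ^ 4 := by positivity
  have hvabs : |v| ≤ 2 * |ξ| := by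
    have e : v = (α - b * ξ ^ 2) * ξ := by rw [hv]; ring
    rw [e, abs_mul]
    refine mul_le_mul_of_nonneg_right ?_ (abs_nonneg _)
    refine (abs_sub _ _).trans ?_
    rw [abs_mul, abs_of_nonneg (sq_nonneg ξ)]
    nlinarith [abs_nonneg b, sq_nonneg ξ]
  have hv1 : |v| ≤ 1 := by linarith
  have hv4 : |v| ^ 4 ≤ 16 * ξ ^ 4 := by
    calc |v| ^ 4 ≤ (2 * |ξ|) ^ 4 := by gcongr
      _ = 16 * |ξ| ^ 4 := by ring
      _ = 16 * ξ ^ 4 := by rw [← abs_pow, abs_of_nonneg hp]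
  have hξ4 : |ξ| ^ 4 = ξ ^ 4 := by rw [← abs_pow, abs_of_nonneg hp]
  have c1 := Real.cos_bound (by linarith : |ξ| ≤ 1)
  have c2 := Real.cos_bound hv1
  have s1 := Real.sin_bound (by linarith : |ξ| ≤ 1)
  have s2 := Real.sin_bound hv1
  have hre : (laxSymbol α ξ - Complex.exp (Complex.I * (v : ℂ))).re
      = α ^ 2 * (Real.cos ξ - (1 - ξ ^ 2 / 2)) - (Real.cos v - (1 - v ^ 2 / 2))
        + ξ ^ 4 * (b * (b * ξ ^ 2 / 2 - α)) := by
    rw [Complex.sub_re, laxSymbol_re, mul_comm Complex.I, Complex.exp_ofReal_mul_I_re]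
    simp only [hv]
    ring
  have him : (laxSymbol α ξ - Complex.exp (Complex.I * (v : ℂ))).im
      = α * (Real.sin ξ - (ξ - ξ ^ 3 / 6)) - (Real.sin v - (v - v ^ 3 / 6))
        + ξ ^ 4 * (ξ * (b * (b * ξ ^ 2 * (3 * α - b * ξ ^ 2) - 3 * α ^ 2)) / 6) := by
    rw [Complex.sub_im, laxSymbol_im, mul_comm Complex.I, Complex.exp_ofReal_mul_I_im]
    simp only [hv, hbdef]
    ring
  have hbξ : |b * ξ ^ 2| ≤ 1 := by
    rw [abs_mul, abs_of_nonneg (sq_nonneg ξ)]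
    nlinarith [abs_nonneg b]
  have p1 : |ξ ^ 4 * (b * (b * ξ ^ 2 / 2 - α))| ≤ ξ ^ 4 * 1 := by
    rw [abs_mul, abs_of_nonneg hp]
    refine mul_le_mul_of_nonneg_left ?_ hp
    rw [abs_mul]
    have : |b * ξ ^ 2 / 2 - α| ≤ 2 := by
      refine (abs_sub _ _).trans ?_
      rw [abs_div, abs_of_pos (by norm_num : (0 : ℝ) < 2)]
      linarith
    nlinarith [abs_nonneg b, abs_nonneg (b * ξ ^ 2 / 2 - α)]
  have p2 : |ξ ^ 4 * (ξ * (b * (b * ξ ^ 2 * (3 * α - b * ξ ^ 2) - 3 * α ^ 2)) / 6)|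
      ≤ ξ ^ 4 * 1 := by
    rw [abs_mul, abs_of_nonneg hp]
    refine mul_le_mul_of_nonneg_left ?_ hp
    rw [abs_div, abs_mul, abs_mul, abs_of_pos (by norm_num : (0 : ℝ) < 6)]
    have h3 : |3 * α - b * ξ ^ 2| ≤ 4 := by
      refine (abs_sub _ _).trans ?_
      rw [abs_mul, abs_of_pos (by norm_num : (0 : ℝ) < 3)]
      linarith
    have h4 : |b * ξ ^ 2 * (3 * α - b * ξ ^ 2)| ≤ 1 * 4 := by
      rw [abs_mul]
      exact mul_le_mul hbξ h3 (abs_nonneg _) zero_le_one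
    have h5 : |b * ξ ^ 2 * (3 * α - b * ξ ^ 2) - 3 * α ^ 2| ≤ 7 := by
      refine (abs_sub _ _).trans ?_
      rw [abs_mul 3, abs_of_pos (by norm_num : (0 : ℝ) < 3), abs_of_nonneg (sq_nonneg α)]
      linarith
    have h6 : |b| * |b * ξ ^ 2 * (3 * α - b * ξ ^ 2) - 3 * α ^ 2| ≤ 1 / 6 * 7 :=
      mul_le_mul hb h5 (abs_nonneg _) (by norm_num)
    have h7 := mul_le_mul hξ h6 (by positivity) (by norm_num)
    linarith
  have q1 : |α ^ 2 * (Real.cos ξ - (1 - ξ ^ 2 / 2))| ≤ ξ ^ 4 := by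
    rw [abs_mul, abs_of_nonneg (sq_nonneg α)]
    rw [hξ4] at c1
    have := mul_le_mul h1.le c1 (abs_nonneg _) zero_le_one
    linarith
  have q2 : |α * (Real.sin ξ - (ξ - ξ ^ 3 / 6))| ≤ ξ ^ 4 := by
    rw [abs_mul]
    have : |ξ| ^ 5 ≤ ξ ^ 4 := by
      rw [pow_succ, hξ4]
      exact mul_le_of_le_one_right hp (by linarith)
    have := mul_le_mul hα s1 (abs_nonneg _) zero_le_one
    linarith
  have q3 : |v| ^ 5 ≤ |v| ^ 4 := pow_le_pow_of_le_one (abs_nonneg v) hv1 (by norm_num)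
  have q4 : 0 ≤ |v| ^ 5 := by positivity
  refine (Complex.norm_le_abs_re_add_abs_im _).trans ?_
  rw [hre, him]
  have t1 := abs_add_le (α ^ 2 * (Real.cos ξ - (1 - ξ ^ 2 / 2)) - (Real.cos v - (1 - v ^ 2 / 2)))
    (ξ ^ 4 * (b * (b * ξ ^ 2 / 2 - α)))
  have t2 := abs_sub (α ^ 2 * (Real.cos ξ - (1 - ξ ^ 2 / 2))) (Real.cos v - (1 - v ^ 2 / 2))
  have t3 := abs_add_le (α * (Real.sin ξ - (ξ - ξ ^ 3 / 6)) - (Real.sin v - (v - v ^ 3 / 6)))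
    (ξ ^ 4 * (ξ * (b * (b * ξ ^ 2 * (3 * α - b * ξ ^ 2) - 3 * α ^ 2)) / 6))
  have t4 := abs_sub (α * (Real.sin ξ - (ξ - ξ ^ 3 / 6))) (Real.sin v - (v - v ^ 3 / 6))
  linarith

/-! ### Local limit theorem for powers of the normalised symbol -/

theorem norm_pow_sub_pow_le_mul {p q : ℂ} (hp : ‖p‖ ≤ 1) (hq : ‖q‖ ≤ 1) (n : ℕ) :
    ‖p ^ n - q ^ n‖ ≤ n * ‖p - q‖ := by
  induction n with
  | zero => simp
  | succ n ih =>
    have e : p ^ (n + 1) - q ^ (n + 1) = p ^ n * (p - q) + (p ^ n - q ^ n) * q := by ring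
    have h1 : ‖p ^ n * (p - q)‖ ≤ 1 * ‖p - q‖ := by
      rw [norm_mul, norm_pow]
      gcongr
      exact pow_le_one₀ (norm_nonneg _) hp
    have h2 : ‖(p ^ n - q ^ n) * q‖ ≤ n * ‖p - q‖ * 1 := by
      rw [norm_mul]
      gcongr
    rw [e]
    push_cast
    linarith [norm_add_le (p ^ n * (p - q)) ((p ^ n - q ^ n) * q)]

/-- The integrand in the Fourier inversion formula for the powers of `laxSymbol`. -/
noncomputable def laxIntegrand (α : ℝ) (n : ℕ) (x ξ : ℝ) : ℂ :=
  laxSymbol α ξ ^ n * Complex.exp (-(Complex.I * x * ξ))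

theorem continuous_laxIntegrand (α : ℝ) (n : ℕ) (x : ℝ) : Continuous (laxIntegrand α n x) := by
  have := continuous_laxSymbol α
  unfold laxIntegrand
  fun_prop

theorem laxIntegrand_neg (α : ℝ) (n : ℕ) (x ξ : ℝ) :
    laxIntegrand α n x (-ξ) = starRingEnd ℂ (laxIntegrand α n x ξ) := by
  rw [laxIntegrand, laxIntegrand, laxSymbol_neg, map_mul, map_pow, ← Complex.exp_conj]
  simp

theorem norm_laxIntegrand (α : ℝ) (n : ℕ) (x ξ : ℝ) :
    ‖laxIntegrand α n x ξ‖ = ‖laxSymbol α ξ‖ ^ n := by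
  rw [laxIntegrand, norm_mul, norm_pow]
  have : -(Complex.I * x * ξ) = ((-(x * ξ) : ℝ) : ℂ) * Complex.I := by push_cast; ring
  rw [this, Complex.norm_exp_ofReal_mul_I, mul_one]

theorem norm_integral_laxIntegrand_le {α : ℝ} (h0 : α ≠ 0) (h1 : α ^ 2 < 1) {r : ℝ}
    (hr : ∀ ξ ∈ Set.Icc (1 / 2 : ℝ) Real.pi, ‖laxSymbol α ξ‖ ≤ r) {n : ℕ} (hn : 0 < n)
    (x : ℝ) {h : ℝ} (hh : 0 < h) (hh2 : h ≤ 1 / 2) :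
    ‖∫ ξ in h..Real.pi, laxIntegrand α n x ξ‖
      ≤ 6 / √(n * |α| * (1 - α ^ 2) * h / 4) + 4 * r ^ n := by
  have hi : ∀ c d, IntervalIntegrable (laxIntegrand α n x) MeasureTheory.volume c d :=
    fun c d => (continuous_laxIntegrand α n x).intervalIntegrable c d
  have hpi : (1 / 2 : ℝ) ≤ Real.pi := by linarith [Real.pi_gt_three]
  rw [← intervalIntegral.integral_add_adjacent_intervals (hi h (1 / 2)) (hi (1 / 2) Real.pi)]
  refine (norm_add_le _ _).trans (add_le_add
    (norm_integral_laxSymbol_near_le h0 h1 hn x hh hh2 le_rfl) ?_)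
  have hr0 : 0 ≤ r := (norm_nonneg _).trans (hr _ ⟨le_rfl, hpi⟩)
  have := intervalIntegral.norm_integral_le_of_norm_le_const (a := 1 / 2) (b := Real.pi)
    (C := r ^ n) (f := laxIntegrand α n x) (fun ξ hξ => by
      rw [Set.uIoc_of_le hpi] at hξ
      rw [norm_laxIntegrand]
      exact pow_le_pow_left₀ (norm_nonneg _) (hr ξ ⟨hξ.1.le, hξ.2⟩) n)
  rw [abs_of_nonneg (by linarith)] at this
  have h4 : Real.pi - 1 / 2 ≤ 4 := by linarith [Real.pi_le_four]
  have := mul_le_mul_of_nonneg_left h4 (pow_nonneg hr0 n)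
  linarith

theorem norm_integral_laxIntegrand_sub_center_le {α : ℝ} (h0 : α ≠ 0) (h1 : α ^ 2 < 1) {r : ℝ}
    (hr : ∀ ξ ∈ Set.Icc (1 / 2 : ℝ) Real.pi, ‖laxSymbol α ξ‖ ≤ r) {n : ℕ} (hn : 0 < n)
    (x : ℝ) {h : ℝ} (hh : 0 < h) (hh2 : h ≤ 1 / 2) :
    ‖(∫ ξ in (-Real.pi)..Real.pi, laxIntegrand α n x ξ) - ∫ ξ in (-h)..h, laxIntegrand α n x ξ‖
      ≤ 2 * (6 / √(n * |α| * (1 - α ^ 2) * h / 4) + 4 * r ^ n) := by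
  have hi : ∀ c d, IntervalIntegrable (laxIntegrand α n x) MeasureTheory.volume c d :=
    fun c d => (continuous_laxIntegrand α n x).intervalIntegrable c d
  have hR := norm_integral_laxIntegrand_le h0 h1 hr hn x hh hh2
  have hL : ‖∫ ξ in (-Real.pi)..(-h), laxIntegrand α n x ξ‖
      ≤ 6 / √(n * |α| * (1 - α ^ 2) * h / 4) + 4 * r ^ n := by
    have h2 := hR
    rw [← Complex.norm_conj, ← intervalIntegral.intervalIntegral_conj] at h2
    simp_rw [← laxIntegrand_neg] at h2
    rwa [intervalIntegral.integral_comp_neg] at h2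
  have e : (∫ ξ in (-Real.pi)..Real.pi, laxIntegrand α n x ξ)
      - ∫ ξ in (-h)..h, laxIntegrand α n x ξ
      = (∫ ξ in (-Real.pi)..(-h), laxIntegrand α n x ξ)
        + ∫ ξ in h..Real.pi, laxIntegrand α n x ξ := by
    rw [← intervalIntegral.integral_add_adjacent_intervals (hi (-Real.pi) (-h)) (hi (-h) Real.pi),
      ← intervalIntegral.integral_add_adjacent_intervals (hi (-h) h) (hi h Real.pi)]
    ring
  rw [e, two_mul]
  exact (norm_add_le _ _).trans (add_le_add hL hR)

/-- After `ξ = u/t` with `t³ = n`, the pointwise error is at most `n · 21(M/t)⁴ = 21M⁴/t`,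
integrated over an interval of length `2M`. -/
theorem norm_center_sub_truncIntegral_le {α : ℝ} (h1 : α ^ 2 < 1) {n : ℕ} {t : ℝ} (ht : 0 < t)
    (htn : t ^ 3 = n) (x : ℝ) {M : ℝ} (hM : 0 < M) (hMt : M / t ≤ 1 / 2) :
    ‖(t : ℂ) * (∫ ξ in (-(M / t))..(M / t), laxIntegrand α n x ξ)
        - truncIntegral ((α - α ^ 3) / 6) M ((x - α * n) / t)‖ ≤ 42 * M ^ 5 / t := by
  have hcd := intervalIntegral.integral_comp_div (a := -M) (b := M) (laxIntegrand α n x) ht.ne'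
  rw [neg_div, Complex.real_smul] at hcd
  have hi1 : IntervalIntegrable (fun u => laxIntegrand α n x (u / t)) MeasureTheory.volume (-M) M :=
    ((continuous_laxIntegrand α n x).comp (continuous_id.div_const t)).intervalIntegrable _ _
  have hi2 := (continuous_attractorIntegrand_right 3 (Complex.I * ((α - α ^ 3) / 6 : ℝ))
    ((x - α * n) / t)).intervalIntegrable (μ := MeasureTheory.volume) (-M) M
  rw [← hcd, truncIntegral, ← intervalIntegral.integral_sub hi1 hi2]
  have hb := intervalIntegral.norm_integral_le_of_norm_le_const (a := -M) (b := M)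
    (C := 21 * M ^ 4 / t) (f := fun u => laxIntegrand α n x (u / t) - attractorIntegrand 3
      (Complex.I * ((α - α ^ 3) / 6 : ℝ)) ((x - α * n) / t) u) (fun u hu => by
      rw [Set.uIoc_of_le (by linarith)] at hu
      have huM : |u| ≤ M := abs_le.2 ⟨hu.1.le, hu.2⟩
      have hut : |u / t| ≤ 1 / 2 := by
        rw [abs_div, abs_of_pos ht]
        exact (div_le_div_of_nonneg_right huM ht.le).trans hMt
      set w : ℝ := α * (u / t) - (α - α ^ 3) / 6 * (u / t) ^ 3 with hw
      have e1 : attractorIntegrand 3 (Complex.I * ((α - α ^ 3) / 6 : ℝ)) ((x - α * n) / t) u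
          = Complex.exp (Complex.I * (w : ℂ)) ^ n
            * Complex.exp (-(Complex.I * x * ((u / t : ℝ) : ℂ))) := by
        rw [attractorIntegrand_three_eq, ← Complex.exp_nat_mul, ← Complex.exp_add]
        congr 1
        have e2 : -((x - α * n) / t * u) - (α - α ^ 3) / 6 * u ^ 3 = n * w - x * (u / t) := by
          rw [hw, ← htn]
          field_simp
          ring
        rw [e2]
        push_cast
        ring
      rw [e1, laxIntegrand, ← sub_mul, norm_mul]
      have e3 : -(Complex.I * x * ((u / t : ℝ) : ℂ)) = ((-(x * (u / t)) : ℝ) : ℂ) * Complex.I := by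
        push_cast; ring
      rw [e3, Complex.norm_exp_ofReal_mul_I, mul_one]
      have hq : ‖Complex.exp (Complex.I * (w : ℂ))‖ ≤ 1 := by
        rw [mul_comm, Complex.norm_exp_ofReal_mul_I]
      refine (norm_pow_sub_pow_le_mul (norm_laxSymbol_le_one h1 _) hq n).trans ?_
      have h4 : (u / t) ^ 4 ≤ M ^ 4 / t ^ 4 := by
        rw [div_pow]
        refine div_le_div_of_nonneg_right ?_ (by positivity)
        have h5 : |u| ^ 4 ≤ M ^ 4 := pow_le_pow_left₀ (abs_nonneg _) huM 4
        rwa [← abs_pow, abs_of_nonneg (by positivity : 0 ≤ u ^ 4)] at h5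
      calc (n : ℝ) * ‖laxSymbol α (u / t) - Complex.exp (Complex.I * (w : ℂ))‖
          ≤ n * (21 * (M ^ 4 / t ^ 4)) := by
            refine mul_le_mul_of_nonneg_left ?_ (Nat.cast_nonneg n)
            exact (norm_laxSymbol_sub_cexp_le h1 hut).trans (by linarith)
        _ = 21 * M ^ 4 / t := by
            rw [← htn]
            field_simp)
  refine hb.trans_eq ?_
  rw [abs_of_nonneg (by linarith)]
  ring

theorem tendsto_twelve_div_sqrt {k : ℝ} (hk : 0 < k) :
    Tendsto (fun M : ℝ => 12 / √(k * M)) atTop (𝓝 0) :=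
  tendsto_const_nhds.div_atTop
    (Real.tendsto_sqrt_atTop.comp (tendsto_id.const_mul_atTop hk))

/-- Uniform local limit theorem for the powers of `laxSymbol`. -/
theorem exists_norm_laxIntegral_sub_le {α : ℝ} (h0 : α ≠ 0) (h1 : α ^ 2 < 1) {ε : ℝ}
    (hε : 0 < ε) : ∃ N : ℕ, ∀ n : ℕ, N ≤ n → ∀ x : ℝ,
    ‖(((n : ℝ) ^ ((1 : ℝ) / 3) : ℝ) : ℂ) * (∫ ξ in (-Real.pi)..Real.pi, laxIntegrand α n x ξ)
      - improperIntegral (attractorIntegrand 3 (Complex.I * ((α - α ^ 3) / 6 : ℝ))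
          ((x - α * n) / (n : ℝ) ^ ((1 : ℝ) / 3)))‖ ≤ ε := by
  have hk : 0 < 1 - α ^ 2 := by linarith
  have hα := abs_pos.2 h0
  have hb : (α - α ^ 3) / 6 ≠ 0 := by
    have : α - α ^ 3 = α * (1 - α ^ 2) := by ring
    rw [this]
    exact div_ne_zero (mul_ne_zero h0 hk.ne') (by norm_num)
  obtain ⟨r, hr0, hr1, hr⟩ := exists_norm_laxSymbol_le h0 h1
  -- `M` is fixed first, making the tails of the profile and of the symbol integral near zero small
  -- for all `n` and `x`; `N` is then chosen in terms of `M`.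
  obtain ⟨M, ⟨hM1, hM2⟩, hM⟩ :=
    ((((tendsto_twelve_div_sqrt (mul_pos (by norm_num : (0 : ℝ) < 6) (abs_pos.2 hb))).eventually
      (gt_mem_nhds (by positivity : 0 < ε / 4))).and
      ((tendsto_twelve_div_sqrt (by positivity : 0 < |α| * (1 - α ^ 2) / 4)).eventually
      (gt_mem_nhds (by positivity : 0 < ε / 4)))).and (eventually_gt_atTop 0)).exists
  have htt : Tendsto (fun n : ℕ => (n : ℝ) ^ ((1 : ℝ) / 3)) atTop atTop :=
    (tendsto_rpow_atTop (by norm_num)).comp tendsto_natCast_atTop_atTop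
  have hA : Tendsto (fun n : ℕ => 42 * M ^ 5 / (n : ℝ) ^ ((1 : ℝ) / 3)) atTop (𝓝 0) :=
    tendsto_const_nhds.div_atTop htt
  have hB : Tendsto (fun n : ℕ => M / (n : ℝ) ^ ((1 : ℝ) / 3)) atTop (𝓝 0) :=
    tendsto_const_nhds.div_atTop htt
  have hC : Tendsto (fun n : ℕ => (n : ℝ) * r ^ n) atTop (𝓝 0) :=
    tendsto_self_mul_const_pow_of_lt_one hr0 hr1
  obtain ⟨N, hN⟩ := eventually_atTop.1
    (((hA.eventually (gt_mem_nhds (by positivity : 0 < ε / 4))).and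
    (hB.eventually (gt_mem_nhds (by norm_num : (0 : ℝ) < 1 / 2)))).and
    ((hC.eventually (gt_mem_nhds (by positivity : 0 < ε / 32))).and (eventually_ge_atTop 1)))
  refine ⟨N, fun n hn x => ?_⟩
  obtain ⟨⟨hA, hB⟩, hC, hn1⟩ := hN n hn
  have hn1' : (1 : ℝ) ≤ n := by exact_mod_cast hn1
  set t : ℝ := (n : ℝ) ^ ((1 : ℝ) / 3) with htdef
  have ht : 0 < t := by positivity
  have htn : t ^ 3 = n := by
    rw [htdef, one_div]
    exact_mod_cast Real.rpow_inv_natCast_pow (n := 3) (Nat.cast_nonneg n) (by norm_num)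
  have htle : t ≤ n := Real.rpow_le_self_of_one_le hn1' (by norm_num)
  have c1 := norm_integral_laxIntegrand_sub_center_le h0 h1 hr hn1 x (div_pos hM ht) hB.le
  have c2 := norm_center_sub_truncIntegral_le h1 ht htn x hM hB.le
  have c3 := norm_improperIntegral_sub_truncIntegral_le hb ((x - α * n) / t) hM
  -- The factor `t` extracted here cancels the prefactor `n^{1/3}`, so the van der Corput tail
  -- depends on `M` alone.
  have hsq : √((n : ℝ) * |α| * (1 - α ^ 2) * (M / t) / 4)
      = t * √(|α| * (1 - α ^ 2) / 4 * M) := by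
    rw [← htn]
    have : t ^ 3 * |α| * (1 - α ^ 2) * (M / t) / 4 = t ^ 2 * (|α| * (1 - α ^ 2) / 4 * M) := by
      field_simp
    rw [this, Real.sqrt_mul (sq_nonneg t), Real.sqrt_sq ht.le]
  have c4 : t * (2 * (6 / √(n * |α| * (1 - α ^ 2) * (M / t) / 4) + 4 * r ^ n))
      ≤ 12 / √(|α| * (1 - α ^ 2) / 4 * M) + 8 * (n * r ^ n) := by
    have e : t * (2 * (6 / √(n * |α| * (1 - α ^ 2) * (M / t) / 4) + 4 * r ^ n))
        = 12 / √(|α| * (1 - α ^ 2) / 4 * M) + 8 * (t * r ^ n) := by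
      rw [hsq]
      have : 0 < √(|α| * (1 - α ^ 2) / 4 * M) := Real.sqrt_pos.2 (by positivity)
      field_simp
      ring
    rw [e]
    gcongr
  set J := ∫ ξ in (-Real.pi)..Real.pi, laxIntegrand α n x ξ
  set J₁ := ∫ ξ in (-(M / t))..(M / t), laxIntegrand α n x ξ
  set T := truncIntegral ((α - α ^ 3) / 6) M ((x - α * n) / t)
  set L := improperIntegral (attractorIntegrand 3 (Complex.I * ((α - α ^ 3) / 6 : ℝ))
          ((x - α * n) / t))
  have e : (t : ℂ) * J - L = (t : ℂ) * (J - J₁) + (t * J₁ - T) - (L - T) := by ring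
  have c5 : ‖(t : ℂ) * (J - J₁)‖ ≤ 12 / √(|α| * (1 - α ^ 2) / 4 * M) + 8 * (n * r ^ n) := by
    rw [norm_mul, Complex.norm_real, Real.norm_of_nonneg ht.le]
    exact (mul_le_mul_of_nonneg_left c1 ht.le).trans c4
  have c6 : 2 * (6 / √(6 * |(α - α ^ 3) / 6| * M)) = 12 / √(6 * |(α - α ^ 3) / 6| * M) := by ring
  rw [c6] at c3
  rw [e]
  linarith [norm_sub_le ((t : ℂ) * (J - J₁) + (t * J₁ - T)) (L - T),
    norm_add_le ((t : ℂ) * (J - J₁)) (t * J₁ - T)]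

/-! ### Convolution powers as Fourier coefficients -/

theorem integral_cexp_int_mul (x : ℤ) :
    (∫ ξ in (-Real.pi)..Real.pi, Complex.exp (-(Complex.I * ((x : ℝ) : ℂ) * ξ)))
      = 2 * Real.pi * (Pi.single 0 1 : ℤ → ℂ) x := by
  rcases eq_or_ne x 0 with rfl | hx
  · simp [two_mul]
  · have hc : -(Complex.I * ((x : ℝ) : ℂ)) ≠ 0 :=
      neg_ne_zero.2 (mul_ne_zero Complex.I_ne_zero (by exact_mod_cast hx))
    have e : ∀ ξ : ℝ, -(Complex.I * ((x : ℝ) : ℂ) * ξ) = -(Complex.I * ((x : ℝ) : ℂ)) * ξ :=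
      fun ξ => (neg_mul _ _).symm
    simp_rw [e]
    rw [integral_exp_mul_complex hc, Pi.single_eq_of_ne hx, mul_zero, div_eq_zero_iff]
    left
    rw [sub_eq_zero, Complex.exp_eq_exp_iff_exists_int]
    refine ⟨-x, ?_⟩
    push_cast
    ring

section NearestNeighbour

variable {φ : ℤ → ℂ} {a₀ ap am : ℝ}

theorem convPow_succ_of_support (h_zero : φ 0 = (a₀ : ℂ)) (h_plus : φ 1 = (ap : ℂ))
    (h_minus : φ (-1) = (am : ℂ)) (h_supp : ∀ x : ℤ, x ≠ 0 → x ≠ 1 → x ≠ -1 → φ x = 0)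
    (n : ℕ) (x : ℤ) :
    convPow φ (n + 1) x
      = convPow φ n x * a₀ + convPow φ n (x - 1) * ap + convPow φ n (x + 1) * am := by
  simp only [convPow]
  rw [tsum_eq_sum (s := {0, 1, -1})]
  · rw [Finset.sum_insert (by decide), Finset.sum_insert (by decide), Finset.sum_singleton,
      h_zero, h_plus, h_minus, sub_zero, sub_neg_eq_add, add_assoc]
  · intro y hy
    simp only [Finset.mem_insert, Finset.mem_singleton, not_or] at hy
    rw [h_supp y hy.1 hy.2.1 hy.2.2, mul_zero]

theorem convPow_eq_zero_of_lt_abs (h_zero : φ 0 = (a₀ : ℂ)) (h_plus : φ 1 = (ap : ℂ))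
    (h_minus : φ (-1) = (am : ℂ)) (h_supp : ∀ x : ℤ, x ≠ 0 → x ≠ 1 → x ≠ -1 → φ x = 0)
    (n : ℕ) (x : ℤ) (hx : (n : ℤ) < |x|) : convPow φ n x = 0 := by
  induction n generalizing x with
  | zero =>
    have : x ≠ 0 := by rintro rfl; simp at hx
    simp [convPow, this]
  | succ n ih =>
    push_cast at hx
    rw [convPow_succ_of_support h_zero h_plus h_minus h_supp, ih x (by omega),
      ih (x - 1) (by have := abs_sub_abs_le_abs_sub x 1; rw [abs_one] at this; omega),
      ih (x + 1) (by have := abs_sub_abs_le_abs_sub x (-1); rw [abs_neg, abs_one] at this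
                     rw [sub_neg_eq_add] at this; omega)]
    simp

theorem exists_norm_convPow_max (h_zero : φ 0 = (a₀ : ℂ)) (h_plus : φ 1 = (ap : ℂ))
    (h_minus : φ (-1) = (am : ℂ)) (h_supp : ∀ x : ℤ, x ≠ 0 → x ≠ 1 → x ≠ -1 → φ x = 0) (n : ℕ) :
    ∃ x : ℤ, ∀ y : ℤ, ‖convPow φ n y‖ ≤ ‖convPow φ n x‖ := by
  obtain ⟨x, -, hx⟩ := (Finset.Icc (-(n : ℤ)) n).exists_max_image
    (fun x => ‖convPow φ n x‖) ⟨0, by simp⟩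
  refine ⟨x, fun y => ?_⟩
  by_cases hy : |y| ≤ (n : ℤ)
  · exact hx y (Finset.mem_Icc.2 (abs_le.1 hy))
  · rw [convPow_eq_zero_of_lt_abs h_zero h_plus h_minus h_supp n y (not_le.1 hy), norm_zero]
    exact norm_nonneg _

/-- The relations `hA`, `hd`, `hs` say exactly that `A` times `laxSymbol` is the symbol of `φ`;
convolving once more then multiplies the integrand by it. The base case is orthogonality of
characters. -/
theorem convPow_eq_integral {A α : ℝ} (h_zero : φ 0 = (a₀ : ℂ)) (h_plus : φ 1 = (ap : ℂ))
    (h_minus : φ (-1) = (am : ℂ)) (h_supp : ∀ x : ℤ, x ≠ 0 → x ≠ 1 → x ≠ -1 → φ x = 0)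
    (hA : A = a₀ + ap + am) (hd : A * α = ap - am) (hs : A * α ^ 2 = ap + am)
    (n : ℕ) (x : ℤ) :
    convPow φ n x = (A : ℂ) ^ n * (1 / (2 * Real.pi)
      * ∫ ξ in (-Real.pi)..Real.pi, laxIntegrand α n x ξ) := by
  have hpi : (2 * Real.pi : ℂ) ≠ 0 := by simp [Real.pi_ne_zero]
  induction n generalizing x with
  | zero =>
    simp only [laxIntegrand, pow_zero, one_mul]
    rw [integral_cexp_int_mul, convPow]
    field_simp
  | succ n ih =>
    have hi : ∀ z : ℝ, IntervalIntegrable (laxIntegrand α n z) MeasureTheory.volume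
        (-Real.pi) Real.pi := fun z => (continuous_laxIntegrand α n z).intervalIntegrable _ _
    have hsymb : ∀ ξ : ℝ, (A : ℂ) * laxSymbol α ξ
        = a₀ + ap * Complex.exp (Complex.I * ξ) + am * Complex.exp (-(Complex.I * ξ)) := by
      intro ξ
      have e1 : Complex.exp (Complex.I * ξ) = Complex.cos ξ + Complex.sin ξ * Complex.I := by
        rw [mul_comm, Complex.exp_mul_I]
      have e2 : Complex.exp (-(Complex.I * ξ)) = Complex.cos ξ - Complex.sin ξ * Complex.I := by
        rw [mul_comm, ← neg_mul, Complex.exp_mul_I, Complex.cos_neg, Complex.sin_neg]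
        ring
      have hA' : (A : ℂ) = a₀ + ap + am := by exact_mod_cast hA
      have hd' : (A : ℂ) * α = ap - am := by exact_mod_cast hd
      have hs' : (A : ℂ) * α ^ 2 = ap + am := by exact_mod_cast hs
      rw [e1, e2, laxSymbol]
      push_cast
      linear_combination hA' - hs' * (1 - Complex.cos ξ) + hd' * Complex.sin ξ * Complex.I
    have hpt : ∀ ξ : ℝ, (A : ℂ) * laxIntegrand α (n + 1) x ξ
        = a₀ * laxIntegrand α n x ξ + ap * laxIntegrand α n ((x - 1 : ℤ) : ℝ) ξ
          + am * laxIntegrand α n ((x + 1 : ℤ) : ℝ) ξ := by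
      intro ξ
      simp only [laxIntegrand]
      have e1 : Complex.exp (-(Complex.I * (((x - 1 : ℤ) : ℝ) : ℂ) * ξ))
          = Complex.exp (-(Complex.I * ((x : ℝ) : ℂ) * ξ)) * Complex.exp (Complex.I * ξ) := by
        rw [← Complex.exp_add]
        push_cast
        congr 1
        ring
      have e2 : Complex.exp (-(Complex.I * (((x + 1 : ℤ) : ℝ) : ℂ) * ξ))
          = Complex.exp (-(Complex.I * ((x : ℝ) : ℂ) * ξ)) * Complex.exp (-(Complex.I * ξ)) := by
        rw [← Complex.exp_add]
        push_cast
        congr 1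
        ring
      rw [e1, e2]
      linear_combination laxSymbol α ξ ^ n * Complex.exp (-(Complex.I * ((x : ℝ) : ℂ) * ξ))
        * hsymb ξ
    have hint : (A : ℂ) * ∫ ξ in (-Real.pi)..Real.pi, laxIntegrand α (n + 1) x ξ
        = a₀ * (∫ ξ in (-Real.pi)..Real.pi, laxIntegrand α n x ξ)
          + ap * (∫ ξ in (-Real.pi)..Real.pi, laxIntegrand α n ((x - 1 : ℤ) : ℝ) ξ)
          + am * ∫ ξ in (-Real.pi)..Real.pi, laxIntegrand α n ((x + 1 : ℤ) : ℝ) ξ := by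
      rw [← intervalIntegral.integral_const_mul]
      simp_rw [hpt]
      rw [intervalIntegral.integral_add (((hi _).const_mul _).add ((hi _).const_mul _))
        ((hi _).const_mul _), intervalIntegral.integral_add ((hi _).const_mul _)
        ((hi _).const_mul _), intervalIntegral.integral_const_mul,
        intervalIntegral.integral_const_mul, intervalIntegral.integral_const_mul]
    rw [convPow_succ_of_support h_zero h_plus h_minus h_supp, ih, ih, ih, pow_succ]
    linear_combination -((A : ℂ) ^ n * (1 / (2 * Real.pi))) * hint

end NearestNeighbour

/-! ### Location of the maxima -/

/-- If `f n` is uniformly approximated by a rescaled profile that is continuous, nonzero at the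
origin and vanishes at infinity, then the maxima of `‖f n‖` stay in a compact rescaled window. -/
theorem exists_isCompact_max_of_local_limit {f : ℕ → ℤ → ℂ} {u : ℕ → ℤ → ℂ} {A α : ℝ} {H : ℝ → ℂ}
    (hA : 0 < A) (hu : ∀ n x, ‖u n x‖ = 1)
    (hmax : ∀ n, ∃ x, ∀ y, ‖f n y‖ ≤ ‖f n x‖) (hH : Continuous H) (hH0 : H 0 ≠ 0)
    (hHinf : Tendsto H (cocompact ℝ) (𝓝 0))
    (hlim : ∀ ε : ℝ, 0 < ε → ∃ N : ℕ, ∀ n : ℕ, N ≤ n → ∀ x : ℤ,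
      ‖f n x - (((n : ℝ) ^ (-(1 : ℝ) / 3) : ℝ) : ℂ) * (A : ℂ) ^ n * u n x *
          H (((x : ℝ) - α * (n : ℝ)) / (n : ℝ) ^ ((1 : ℝ) / 3))‖
        ≤ ε * (A ^ n * (n : ℝ) ^ (-(1 : ℝ) / 3))) :
    ∃ K : Set ℝ, IsCompact K ∧ ∀ n : ℕ, 1 ≤ n → ∃ x : ℤ,
      (∃ k ∈ K, (x : ℝ) = α * (n : ℝ) + k * (n : ℝ) ^ ((1 : ℝ) / 3)) ∧
      ∀ y : ℤ, ‖f n y‖ ≤ ‖f n x‖ := by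
  have hm : 0 < ‖H 0‖ := norm_pos_iff.2 hH0
  set m := ‖H 0‖ with hmdef
  obtain ⟨δ, hδ, hnear⟩ := Metric.eventually_nhds_iff.1
    (hH.norm.continuousAt.eventually (lt_mem_nhds (by linarith : 3 * m / 4 < ‖H 0‖)))
  have hfar := (tendsto_norm_zero.comp hHinf).eventually (gt_mem_nhds (by linarith : 0 < m / 4))
  rw [Filter.eventually_iff, Filter.mem_cocompact] at hfar
  obtain ⟨K₀, hK₀, hfar⟩ := hfar
  obtain ⟨N, hN⟩ := hlim (m / 8) (by linarith)
  have htt : Tendsto (fun n : ℕ => (n : ℝ) ^ ((1 : ℝ) / 3)) atTop atTop :=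
    (tendsto_rpow_atTop (by norm_num)).comp tendsto_natCast_atTop_atTop
  obtain ⟨N', hN'⟩ := eventually_atTop.1 (htt.eventually_gt_atTop (1 / δ))
  choose X hX using hmax
  set k : ℕ → ℝ := fun n => ((X n : ℝ) - α * n) / (n : ℝ) ^ ((1 : ℝ) / 3) with hk
  have hkK : ∀ n, max (max N N') 1 ≤ n → k n ∈ K₀ := by
    intro n hn
    have hnN : N ≤ n := le_trans (le_trans (le_max_left _ _) (le_max_left _ _)) hn
    have hnN' : N' ≤ n := le_trans (le_trans (le_max_right _ _) (le_max_left _ _)) hn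
    have hn1 : 0 < n := lt_of_lt_of_le one_pos (le_trans (le_max_right _ _) hn)
    have hn1' : (0 : ℝ) < n := by exact_mod_cast hn1
    have ht : 0 < (n : ℝ) ^ ((1 : ℝ) / 3) := by positivity
    have hD : 0 < A ^ n * (n : ℝ) ^ (-(1 : ℝ) / 3) := by positivity
    have hnorm : ∀ x : ℤ, ‖(((n : ℝ) ^ (-(1 : ℝ) / 3) : ℝ) : ℂ) * (A : ℂ) ^ n * u n x *
          H (((x : ℝ) - α * (n : ℝ)) / (n : ℝ) ^ ((1 : ℝ) / 3))‖
        = ‖H (((x : ℝ) - α * (n : ℝ)) / (n : ℝ) ^ ((1 : ℝ) / 3))‖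
          * (A ^ n * (n : ℝ) ^ (-(1 : ℝ) / 3)) := by
      intro x
      rw [norm_mul, norm_mul, norm_mul, hu, norm_pow, Complex.norm_real, Complex.norm_real,
        Real.norm_of_nonneg hA.le, Real.norm_of_nonneg (by positivity)]
      ring
    -- In units of `A^n n^{-1/3}`, a maximiser outside `K₀` has size below `m/4 + m/8`, while the
    -- integer `⌊αn⌋`, whose rescaled offset is less than `δ`, gives more than `3m/4 - m/8`.
    by_contra hout
    have h1 : ‖H (k n)‖ < m / 4 := hfar hout
    have h2 := hN n hnN (X n)
    have h3 := norm_sub_norm_le (f n (X n)) ((((n : ℝ) ^ (-(1 : ℝ) / 3) : ℝ) : ℂ) * (A : ℂ) ^ n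
      * u n (X n) * H (((X n : ℝ) - α * (n : ℝ)) / (n : ℝ) ^ ((1 : ℝ) / 3)))
    rw [hnorm] at h3
    have h4 := hN n hnN ⌊α * n⌋
    rw [norm_sub_rev] at h4
    have h5 := norm_sub_norm_le ((((n : ℝ) ^ (-(1 : ℝ) / 3) : ℝ) : ℂ) * (A : ℂ) ^ n
      * u n ⌊α * n⌋ * H (((⌊α * n⌋ : ℝ) - α * (n : ℝ)) / (n : ℝ) ^ ((1 : ℝ) / 3)))
      (f n ⌊α * n⌋)
    rw [hnorm] at h5
    have h6 : 3 * m / 4 < ‖H (((⌊α * n⌋ : ℝ) - α * (n : ℝ)) / (n : ℝ) ^ ((1 : ℝ) / 3))‖ := by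
      apply hnear
      rw [Real.dist_eq, sub_zero, abs_div, abs_of_pos ht, div_lt_iff₀ ht]
      have : |(⌊α * n⌋ : ℝ) - α * n| ≤ 1 := by
        rw [abs_le]
        constructor
        · linarith [Int.lt_floor_add_one (α * n)]
        · linarith [Int.floor_le (α * n)]
      have h7 := hN' n hnN'
      rw [div_lt_iff₀ hδ] at h7
      linarith
    have h8 := hX n ⌊α * n⌋
    have h9 : 3 * m / 4 * (A ^ n * (n : ℝ) ^ (-(1 : ℝ) / 3)) ≤ _ :=
      mul_le_mul_of_nonneg_right h6.le hD.le
    have h10 : ‖H (k n)‖ * (A ^ n * (n : ℝ) ^ (-(1 : ℝ) / 3)) ≤ _ :=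
      mul_le_mul_of_nonneg_right h1.le hD.le
    have h11 : 0 < m * (A ^ n * (n : ℝ) ^ (-(1 : ℝ) / 3)) := mul_pos hm hD
    simp only [hk] at h10
    linarith
  -- The finitely many small `n` are covered by adding their rescaled maximisers to `K₀`.
  refine ⟨K₀ ∪ k '' (Set.Iio (max (max N N') 1)),
    hK₀.union ((Set.finite_Iio _).image k).isCompact, fun n hn => ⟨X n, ⟨k n, ?_, ?_⟩, hX n⟩⟩
  · rcases le_or_gt (max (max N N') 1) n with h | h
    · exact Or.inl (hkK n h)
    · exact Or.inr ⟨n, h, rfl⟩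
  · have hn1' : (0 : ℝ) < n := by exact_mod_cast hn
    have ht : 0 < (n : ℝ) ^ ((1 : ℝ) / 3) := by positivity
    simp only [hk]
    field_simp
    ring

/-! ### Twisting by the sign character -/

/-- The character `x ↦ e^{-iπx} = (-1)^x` of `ℤ`. -/
noncomputable def signChar (x : ℤ) : ℂ := Complex.exp (-(Complex.I * (x : ℂ) * (Real.pi : ℂ)))

theorem signChar_add (x y : ℤ) : signChar (x + y) = signChar x * signChar y := by
  rw [signChar, signChar, signChar, ← Complex.exp_add]
  push_cast
  congr 1
  ring

theorem signChar_zero : signChar 0 = 1 := by simp [signChar]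

theorem signChar_neg_one : signChar (-1) = -1 := by
  rw [signChar, ← Complex.exp_pi_mul_I]
  push_cast
  congr 1
  ring

theorem signChar_one : signChar 1 = -1 := by
  have h := signChar_add 1 (-1)
  rw [add_neg_cancel, signChar_zero, signChar_neg_one] at h
  linear_combination h

theorem norm_signChar (x : ℤ) : ‖signChar x‖ = 1 := by
  have : -(Complex.I * (x : ℂ) * (Real.pi : ℂ)) = ((-(x * Real.pi) : ℝ) : ℂ) * Complex.I := by
    push_cast
    ring
  rw [signChar, this, Complex.norm_exp_ofReal_mul_I]

theorem convPow_signChar_mul (φ : ℤ → ℂ) (n : ℕ) (x : ℤ) :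
    convPow (fun x => signChar x * φ x) n x = signChar x * convPow φ n x := by
  induction n generalizing x with
  | zero =>
    rcases eq_or_ne x 0 with rfl | hx
    · simp [convPow, signChar_zero]
    · simp [convPow, hx]
  | succ n ih =>
    simp only [convPow]
    rw [← tsum_mul_left]
    congr 1
    funext y
    rw [ih]
    have := signChar_add (x - y) y
    rw [sub_add_cancel] at this
    rw [this]
    ring

theorem signChar_mul_self (x : ℤ) : signChar x * signChar x = 1 := by
  rw [signChar, ← Complex.exp_add, Complex.exp_eq_one_iff]
  exact ⟨-x, by push_cast; ring⟩

/-! ### Parameter identities and the two cases -/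

theorem local_limit_of_pos {φ : ℤ → ℂ} {a₀ ap am : ℝ}
    (h_zero : φ 0 = (a₀ : ℂ)) (h_plus : φ 1 = (ap : ℂ)) (h_minus : φ (-1) = (am : ℂ))
    (h_supp : ∀ x : ℤ, x ≠ 0 → x ≠ 1 → x ≠ -1 → φ x = 0)
    (h_neg : ap * am < 0) (h_eq : 4 * |ap * am| = a₀ * |ap + am|) (hpos : 0 < ap + am)
    {A α : ℝ} {β : ℂ} (hA : A = a₀ + ap + am) (hα : α = (ap - am) / A)
    (hβ : β = Complex.I * ((α : ℂ) - (α : ℂ) ^ 3) / 6) :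
    0 < A ∧ (∃ b : ℝ, b ≠ 0 ∧ β = Complex.I * b) ∧
    ∀ ε : ℝ, 0 < ε → ∃ N : ℕ, ∀ n : ℕ, N ≤ n → ∀ x : ℤ,
      ‖convPow φ n x - (((n : ℝ) ^ (-(1 : ℝ) / 3) : ℝ) : ℂ) * (A : ℂ) ^ n *
          attractor 3 β (((x : ℝ) - α * (n : ℝ)) / (n : ℝ) ^ ((1 : ℝ) / 3))‖
        ≤ ε * (A ^ n * (n : ℝ) ^ (-(1 : ℝ) / 3)) := by
  rw [abs_of_neg h_neg, abs_of_pos hpos] at h_eq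
  have ha₀ : 0 < a₀ := by
    by_contra h
    nlinarith [mul_nonneg (neg_nonneg.2 (not_lt.1 h)) hpos.le]
  have hApos : 0 < A := by rw [hA]; linarith
  have hd : A * α = ap - am := by rw [hα]; field_simp
  -- This is where the critical relation `-4 ap am = a₀(ap + am)` enters: it turns `(ap - am)²` into
  -- `A(ap + am)`.
  have hs : A * α ^ 2 = ap + am := by
    have h1 : A * (A * α ^ 2) = A * (ap + am) := by
      have : A * (A * α ^ 2) = (ap - am) ^ 2 := by rw [← hd]; ring
      rw [this, hA]
      linarith
    exact mul_left_cancel₀ hApos.ne' h1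
  have hα0 : α ≠ 0 := by
    rintro rfl
    linarith
  -- Equivalent to `ap + am < A`, that is to `a₀ > 0`.
  have hα1 : α ^ 2 < 1 := by
    by_contra h
    have := mul_le_mul_of_nonneg_left (not_lt.1 h) hApos.le
    linarith
  have hβ' : β = Complex.I * ((α - α ^ 3) / 6 : ℝ) := by
    rw [hβ]
    push_cast
    ring
  have hb : (α - α ^ 3) / 6 ≠ 0 := by
    have : α - α ^ 3 = α * (1 - α ^ 2) := by ring
    rw [this]
    exact div_ne_zero (mul_ne_zero hα0 (by linarith)) (by norm_num)
  refine ⟨hApos, ⟨_, hb, hβ'⟩, fun ε hε => ?_⟩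
  -- The tolerance `2πε` absorbs the factor `1/(2π)` of Fourier inversion.
  obtain ⟨N, hN⟩ := exists_norm_laxIntegral_sub_le hα0 hα1 (ε := 2 * Real.pi * ε)
    (by have := Real.pi_pos; positivity)
  refine ⟨max N 1, fun n hn x => ?_⟩
  have hn1 : 0 < n := lt_of_lt_of_le one_pos (le_trans (le_max_right _ _) hn)
  have hn1' : (0 : ℝ) < n := by exact_mod_cast hn1
  have h := hN n (le_trans (le_max_left _ _) hn) x
  rw [convPow_eq_integral h_zero h_plus h_minus h_supp hA hd hs, attractor, hβ']
  have hinv : (n : ℝ) ^ (-(1 : ℝ) / 3) = ((n : ℝ) ^ ((1 : ℝ) / 3))⁻¹ := by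
    rw [← Real.rpow_neg hn1'.le]
    congr 1
    ring
  have ht : 0 < (n : ℝ) ^ ((1 : ℝ) / 3) := by positivity
  rw [hinv]
  set t := (n : ℝ) ^ ((1 : ℝ) / 3)
  set J := ∫ ξ in (-Real.pi)..Real.pi, laxIntegrand α n x ξ
  set L := improperIntegral (attractorIntegrand 3 (Complex.I * ((α - α ^ 3) / 6 : ℝ))
          ((x - α * n) / t))
  have e : (A : ℂ) ^ n * (1 / (2 * Real.pi) * J)
      - ((t⁻¹ : ℝ) : ℂ) * (A : ℂ) ^ n * (1 / (2 * Real.pi) * L)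
      = ((A ^ n * t⁻¹ / (2 * Real.pi) : ℝ) : ℂ) * (t * J - L) := by
    have ht' : (t : ℂ) ≠ 0 := by exact_mod_cast ht.ne'
    push_cast
    field_simp
  have hc : 0 < A ^ n * t⁻¹ / (2 * Real.pi) := by have := Real.pi_pos; positivity
  rw [e, norm_mul, Complex.norm_real, Real.norm_of_nonneg hc.le]
  refine (mul_le_mul_of_nonneg_left h hc.le).trans_eq ?_
  have := Real.pi_pos
  field_simp

theorem mainTheorem8 (φ : ℤ → ℂ) (a₀ ap am : ℝ)
    (h_zero : φ 0 = (a₀ : ℂ)) (h_plus : φ 1 = (ap : ℂ)) (h_minus : φ (-1) = (am : ℂ))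
    (h_supp : ∀ x : ℤ, x ≠ 0 → x ≠ 1 → x ≠ -1 → φ x = 0)
    (h_neg : ap * am < 0) (h_eq : 4 * |ap * am| = a₀ * |ap + am|) :
    (0 < ap + am → ∀ (A α : ℝ) (β : ℂ),
      A = a₀ + ap + am → α = (ap - am) / A → β = Complex.I * ((α : ℂ) - (α : ℂ) ^ 3) / 6 →
        (∀ y : ℝ, ∃ l : ℂ, HasImproperIntegral (attractorIntegrand 3 β y) l) ∧
        (∀ ε : ℝ, 0 < ε → ∃ N : ℕ, ∀ n : ℕ, N ≤ n → ∀ x : ℤ,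
          ‖convPow φ n x -
              (((n : ℝ) ^ (-(1 : ℝ) / 3) : ℝ) : ℂ) * (A : ℂ) ^ n *
                attractor 3 β (((x : ℝ) - α * (n : ℝ)) / (n : ℝ) ^ ((1 : ℝ) / 3))‖
            ≤ ε * (A ^ n * (n : ℝ) ^ (-(1 : ℝ) / 3))) ∧
        (∃ K : Set ℝ, IsCompact K ∧ ∀ n : ℕ, 1 ≤ n → ∃ x : ℤ,
          (∃ k ∈ K, (x : ℝ) = α * (n : ℝ) + k * (n : ℝ) ^ ((1 : ℝ) / 3)) ∧
          ∀ y : ℤ, ‖convPow φ n y‖ ≤ ‖convPow φ n x‖)) ∧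
    (ap + am < 0 → ∀ (A α : ℝ) (β : ℂ),
      A = a₀ - ap - am → α = (am - ap) / A → β = Complex.I * ((α : ℂ) - (α : ℂ) ^ 3) / 6 →
        (∀ y : ℝ, ∃ l : ℂ, HasImproperIntegral (attractorIntegrand 3 β y) l) ∧
        (∀ ε : ℝ, 0 < ε → ∃ N : ℕ, ∀ n : ℕ, N ≤ n → ∀ x : ℤ,
          ‖convPow φ n x -
              (((n : ℝ) ^ (-(1 : ℝ) / 3) : ℝ) : ℂ) * (A : ℂ) ^ n *
                Complex.exp (-(Complex.I * (x : ℂ) * (Real.pi : ℂ))) *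
                attractor 3 β (((x : ℝ) - α * (n : ℝ)) / (n : ℝ) ^ ((1 : ℝ) / 3))‖
            ≤ ε * (A ^ n * (n : ℝ) ^ (-(1 : ℝ) / 3))) ∧
        (∃ K : Set ℝ, IsCompact K ∧ ∀ n : ℕ, 1 ≤ n → ∃ x : ℤ,
          (∃ k ∈ K, (x : ℝ) = α * (n : ℝ) + k * (n : ℝ) ^ ((1 : ℝ) / 3)) ∧
          ∀ y : ℤ, ‖convPow φ n y‖ ≤ ‖convPow φ n x‖)) := by
  constructor
  · intro hpos A α β hA hα hβ
    obtain ⟨hA0, ⟨b, hb, hβ'⟩, hlim⟩ :=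
      local_limit_of_pos h_zero h_plus h_minus h_supp h_neg h_eq hpos hA hα hβ
    subst hβ'
    refine ⟨exists_hasImproperIntegral_attractorIntegrand hb, hlim, ?_⟩
    exact exists_isCompact_max_of_local_limit (u := fun _ _ => 1) hA0 (fun _ _ => norm_one)
      (exists_norm_convPow_max h_zero h_plus h_minus h_supp) (continuous_attractor_three hb)
      (attractor_three_zero_ne_zero hb) (tendsto_attractor_three_cocompact hb)
      (by simpa only [mul_one] using hlim)
  · intro hneg A α β hA hα hβ
    -- The twist keeps `a₀` and negates `ap` and `am`, which makes their sum positive and preserves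
    -- both hypotheses; `A` and `α` then agree with those of the positive case.
    have hflip : ∀ n x, convPow φ n x
        = signChar x * convPow (fun x => signChar x * φ x) n x := by
      intro n x
      rw [convPow_signChar_mul, ← mul_assoc, signChar_mul_self, one_mul]
    obtain ⟨hA0, ⟨b, hb, hβ'⟩, hlim'⟩ :=
      local_limit_of_pos (φ := fun x => signChar x * φ x) (a₀ := a₀) (ap := -ap) (am := -am)
        (A := A) (α := α) (β := β)
        (by rw [signChar_zero, one_mul, h_zero])
        (by rw [signChar_one, h_plus]; push_cast; ring)
        (by rw [signChar_neg_one, h_minus]; push_cast; ring)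
        (fun x h0 h1 h2 => by rw [h_supp x h0 h1 h2, mul_zero])
        (by linarith) (by rw [neg_mul_neg, ← neg_add, abs_neg]; exact h_eq) (by linarith)
        (by rw [hA]; ring) (by rw [hα]; ring) hβ
    subst hβ'
    have hlim : ∀ ε : ℝ, 0 < ε → ∃ N : ℕ, ∀ n : ℕ, N ≤ n → ∀ x : ℤ,
        ‖convPow φ n x - (((n : ℝ) ^ (-(1 : ℝ) / 3) : ℝ) : ℂ) * (A : ℂ) ^ n * signChar x *
          attractor 3 (Complex.I * b) (((x : ℝ) - α * (n : ℝ)) / (n : ℝ) ^ ((1 : ℝ) / 3))‖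
        ≤ ε * (A ^ n * (n : ℝ) ^ (-(1 : ℝ) / 3)) := by
      intro ε hε
      obtain ⟨N, hN⟩ := hlim' ε hε
      refine ⟨N, fun n hn x => ?_⟩
      have h := hN n hn x
      rw [hflip, mul_right_comm, mul_comm _ (signChar x), ← mul_sub, norm_mul, norm_signChar,
        one_mul]
      exact h
    refine ⟨exists_hasImproperIntegral_attractorIntegrand hb, hlim, ?_⟩
    exact exists_isCompact_max_of_local_limit (u := fun _ x => signChar x) hA0
      (fun _ x => norm_signChar x) (exists_norm_convPow_max h_zero h_plus h_minus h_supp)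
      (continuous_attractor_three hb) (attractor_three_zero_ne_zero hb)
      (tendsto_attractor_three_cocompact hb) hlim
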